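/- Let $E$ be a second countable locally compact Hausdorff groupoid (composition and inversion are continuous) with unit space $E^{(0)}$, range and source maps $r,s:E\to E^{(0)}$, $E^u=r^{-1}(u)$, and Haar system $\{\lambda^u\}_{u\in E^{(0)}}$: Radon measures on $E$ with $\operatorname{supp}\lambda^u=E^u$, such that $u\mapsto\int_E f\,d\lambda^u$ is continuous for all $f\in C_c(E)$ and $\int_E f(\eta\gamma)\,d\lambda^{s(\eta)}(\gamma)=\int_E f(\gamma)\,d\lambda^{r(\eta)}(\gamma)$ for all $\eta\in E$, $f\in C_c(E)$. Assume that $E$ is principal ($r(\gamma)=s(\gamma)$ only if $\gamma$ is a unit) and proper ($\{\gamma\in E: s(\gamma)\in K,\ r(\gamma)\in L\}$ is compact for all compact $K,L\subset E^{(0)}$). Let $p:\mathscr A\to E^{(0)}$ be an upper semicontinuous $C^*$-bundle, that is, a topological space $\mathscr A$ with a continuous open surjection $p$ whose fibres $A(u)=p^{-1}(u)$ are $C^*$-algebras, such that: $a\mapsto\|a\|$ is upper semicontinuous; addition and multiplication are continuous on $\{(a,b)\in\mathscr A\times\mathscr A: p(a)=p(b)\}$; the involution and, for each $\kappa\in\mathbb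 C$, the map $a\mapsto\kappa a$ are continuous; and if $(a_i)$ is a net with $\|a_i\|\to0$ and $p(a_i)\to u$, then $a_i\to 0_u$. Write $\Gamma^b$, $\Gamma_c$, $\Gamma_0$ for the continuous sections of $\mathscr A$ that are bounded, compactly supported, vanishing at infinity, respectively. Assume that $A=\Gamma_0(E^{(0)},\mathscr A)$ is separable, and let $M(A)$ be its multiplier algebra. Let $(A,\alpha)$ be an $E$-dynamical system: $*$-isomorphisms $\alpha_\gamma:A(s(\gamma))\to A(r(\gamma))$, $\gamma\in E$, with $\alpha_\gamma\alpha_\eta=\alpha_{\gamma\eta}$ whenever $s(\gamma)=r(\eta)$, such that $(\gamma,a)\mapsto\alpha_\gamma(a)$ is continuous on $\{(\gamma,a): s(\gamma)=p(a)\}$. Put $$\operatorname{Ind}(A,\alpha)=\{f\in\Gamma^b(E^{(0)},\mathscr A): f(r(\gamma))=\alpha_\gamma(f(s(\gamma)))\ \text{for all }\gamma\in E,\ \text{and } E\cdot u\mapsto\|f(u)\| \text{ vanishes at infinity on } E\backslash E^{(0)}\},$$ and for $h\in\Gamma_c(E^{(0)},\mathscr A)$ put $\lambda(h)(u)=\int_E\alpha_\gamma(h(s(\gamma)))\,d\lambda^u(\gamma)$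 for $u\in E^{(0)}$. Then for all $a,b\in\Gamma_c(E^{(0)},\mathscr A)$ the integrals defining $\lambda(a^*b)$ exist and $\lambda(a^*b)\in\operatorname{Ind}(A,\alpha)$; the algebra $\Gamma^b(E^{(0)},\mathscr A)$, acting on $A$ by pointwise left and right multiplication, is isometrically contained in $M(A)$; and, in $M(A)$, the generalized fixed point algebra $$\operatorname{Fix}(A,\alpha)=\overline{\operatorname{span}}\{\lambda(a^*b): a,b\in\Gamma_c(E^{(0)},\mathscr A)\}\subset M(A)$$ (norm closure) is equal to $\operatorname{Ind}(A,\alpha)$. -/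

import Mathlib

open CategoryTheory MeasureTheory Filter Topology Bundle
open scoped ENNReal MultiplierAlgebra

noncomputable section

namespace GroupoidFix

universe u v w

/-! ### Groupoids

A groupoid `E` is presented as a category `X` (a type with a `CategoryTheory.Groupoid` structure)
whose objects form the unit space and whose morphisms, collected in `Arr X`, are the elements
of `E`.  A morphism `γ : x ⟶ y` has source `s(γ) = x` and range `r(γ) = y`, and the product
`γη`, defined when `s(γ) = r(η)`, is the composite "first `η`, then `γ`". -/

/-- The set of all arrows of a groupoid. -/
@[ext]
structure Arr (X : Type u) [Groupoid.{v} X] where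
  /-- the source of the arrow -/
  src : X
  /-- the range of the arrow -/
  tgt : X
  /-- the arrow itself -/
  hom : src ⟶ tgt

variable {X : Type u} [Groupoid.{v} X]

namespace Arr

/-- The identity arrow at a unit. -/
def unit (x : X) : Arr X := ⟨x, x, 𝟙 x⟩

/-- The inverse of an arrow. -/
def inv (γ : Arr X) : Arr X := ⟨γ.tgt, γ.src, Groupoid.inv γ.hom⟩

/-- The product `γη` of two arrows with `s(γ) = r(η)`. -/
def mul (γ η : Arr X) (h : γ.src = η.tgt) : Arr X :=
  ⟨η.src, γ.tgt, η.hom ≫ eqToHom h.symm ≫ γ.hom⟩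

end Arr

/-- A topological groupoid: composition and inversion are continuous, and the objects carry the
topology of the set of identity arrows. -/
class TopologicalGroupoid (X : Type u) [Groupoid.{v} X] [TopologicalSpace X]
    [TopologicalSpace (Arr X)] : Prop where
  continuous_mul : Continuous fun p : {p : Arr X × Arr X // p.1.src = p.2.tgt} =>
    Arr.mul p.1.1 p.1.2 p.2
  continuous_inv : Continuous (Arr.inv : Arr X → Arr X)
  isInducing_unit : IsInducing (Arr.unit : X → Arr X)

/-- A groupoid is principal if the action `γ · s(γ) = r(γ)` on its unit space is free: only units
fix a point. -/
def IsPrincipal (X : Type u) [Groupoid.{v} X] : Prop :=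
  ∀ γ : Arr X, γ.tgt = γ.src → γ = Arr.unit γ.src

/-- A groupoid is proper if the action `γ · s(γ) = r(γ)` on its unit space is proper:
`{γ | γ · K ∩ L ≠ ∅}` is compact for all compact sets `K` and `L` of units. -/
def IsProperGroupoid (X : Type u) [Groupoid.{v} X] [TopologicalSpace X]
    [TopologicalSpace (Arr X)] : Prop :=
  ∀ K L : Set X, IsCompact K → IsCompact L → IsCompact {γ : Arr X | γ.src ∈ K ∧ γ.tgt ∈ L}

/-- Two units are in the same orbit if an arrow joins them. -/
def orbitSetoid (X : Type u) [Groupoid.{v} X] : Setoid X where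
  r x y := Nonempty (x ⟶ y)
  iseqv :=
    { refl := fun x => ⟨𝟙 x⟩
      symm := fun ⟨γ⟩ => ⟨Groupoid.inv γ⟩
      trans := fun ⟨γ⟩ ⟨η⟩ => ⟨γ ≫ η⟩ }

/-- The orbit space of the unit space, with the quotient topology. -/
abbrev OrbitSpace (X : Type u) [Groupoid.{v} X] : Type u := Quotient (orbitSetoid X)

/-- The orbit of a unit, as a point of the orbit space. -/
def orbit (x : X) : OrbitSpace X := Quotient.mk (orbitSetoid X) x

open Classical in
/-- A (left) Haar system: Radon measures `λ^u` on the space of arrows (on a second countable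
locally compact Hausdorff space these are the Borel measures that are finite on compact sets),
with support exactly the arrows of range `u`, depending continuously on `u` and
left invariant. -/
structure HaarSystem (X : Type u) [Groupoid.{v} X] [TopologicalSpace X]
    [TopologicalSpace (Arr X)] [MeasurableSpace (Arr X)] where
  /-- the measure `λ^u` -/
  measure : X → Measure (Arr X)
  finite_on_compacts : ∀ u, IsFiniteMeasureOnCompacts (measure u)
  support_eq : ∀ u, (measure u).support = {γ | γ.tgt = u}
  continuous_integral : ∀ f : Arr X → ℂ, Continuous f → HasCompactSupport f →
    Continuous fun u => ∫ γ, f γ ∂measure u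
  /-- `∫ f(ηγ) dλ^{s(η)}(γ) = ∫ f(γ) dλ^{r(η)}(γ)`; the measure `λ^{s(η)}` lives on the arrows `γ`
  for which `ηγ` is defined. -/
  left_invariant : ∀ (η : Arr X) (f : Arr X → ℂ), Continuous f → HasCompactSupport f →
    ∫ γ, (if h : η.src = γ.tgt then f (η.mul γ h) else 0) ∂measure η.src =
      ∫ γ, f γ ∂measure η.tgt

/-! ### Upper semicontinuous bundles of C⋆-algebras

A bundle over `B` is given by its fibres `A x`, `x : B`, and a topology on the total space
`Bundle.TotalSpace Unit A` (whose first argument is a dummy).  Fibred products and pullbacks carry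
Mathlib's topologies `FiberBundle.Prod.topologicalSpace` and `Pullback.TotalSpace.topologicalSpace`,
which are the relative topologies of the products of the total spaces involved. -/

/-- Upper semicontinuous C⋆-bundles.  In the axiom `tendsto_zero` filters play the role of nets. -/
class UscCStarBundle {B : Type u} [TopologicalSpace B] (A : B → Type w)
    [∀ x, NonUnitalCStarAlgebra (A x)] [TopologicalSpace (TotalSpace Unit A)] : Prop where
  continuous_proj : Continuous (TotalSpace.proj : TotalSpace Unit A → B)
  isOpenMap_proj : IsOpenMap (TotalSpace.proj : TotalSpace Unit A → B)
  upperSemicontinuous_norm : UpperSemicontinuous fun z : TotalSpace Unit A => ‖z.snd‖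
  continuous_add : Continuous fun z : TotalSpace (Unit × Unit) (A ×ᵇ A) =>
    (⟨z.proj, z.snd.1 + z.snd.2⟩ : TotalSpace Unit A)
  continuous_smul : ∀ κ : ℂ, Continuous fun z : TotalSpace Unit A =>
    (⟨z.proj, κ • z.snd⟩ : TotalSpace Unit A)
  tendsto_zero : ∀ (F : Filter (TotalSpace Unit A)) (x : B),
    Tendsto (fun z => ‖z.snd‖) F (𝓝 0) → Tendsto TotalSpace.proj F (𝓝 x) →
      F ≤ 𝓝 (⟨x, 0⟩ : TotalSpace Unit A)
  continuous_mul : Continuous fun z : TotalSpace (Unit × Unit) (A ×ᵇ A) =>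
    (⟨z.proj, z.snd.1 * z.snd.2⟩ : TotalSpace Unit A)
  continuous_star : Continuous fun z : TotalSpace Unit A =>
    (⟨z.proj, star z.snd⟩ : TotalSpace Unit A)

section Sections

variable {B : Type u} {A : B → Type w} [∀ x, NonUnitalCStarAlgebra (A x)]

/-- The norm of a section `f` vanishes at infinity along a map `q` (the identity map of the base
space, or the quotient map onto the orbit space): for every `ε > 0` there is a compact set `K` such
that `‖f x‖ < ε` unless `q x ∈ K`. -/
def VanishesAtInfinityAlong {Y : Type*} [TopologicalSpace Y] (q : B → Y) (f : ∀ x, A x) : Prop :=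
  ∀ ε : ℝ, 0 < ε → ∃ K : Set Y, IsCompact K ∧ ∀ x, q x ∉ K → ‖f x‖ < ε

section Vanish

variable {Y : Type*} [TopologicalSpace Y] {q : B → Y} {f g : ∀ x, A x}

theorem VanishesAtInfinityAlong.of_le (hf : VanishesAtInfinityAlong q f) (C : ℝ)
    (h : ∀ x, ‖g x‖ ≤ C * ‖f x‖) : VanishesAtInfinityAlong q g := by
  intro ε hε
  have hC : 0 < |C| + 1 := by positivity
  obtain ⟨K, hK, hfK⟩ := hf (ε / (|C| + 1)) (div_pos hε hC)
  refine ⟨K, hK, fun x hx => ?_⟩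
  have h1 := hfK x hx
  rw [lt_div_iff₀ hC] at h1
  have h2 := h x
  have h3 : C * ‖f x‖ ≤ |C| * ‖f x‖ := mul_le_mul_of_nonneg_right (le_abs_self C) (norm_nonneg _)
  nlinarith [norm_nonneg (f x)]

theorem VanishesAtInfinityAlong.zero : VanishesAtInfinityAlong q (fun x => (0 : A x)) :=
  fun ε hε => ⟨∅, isCompact_empty, fun x _ => by simpa using hε⟩

theorem VanishesAtInfinityAlong.add (hf : VanishesAtInfinityAlong q f)
    (hg : VanishesAtInfinityAlong q g) : VanishesAtInfinityAlong q (fun x => f x + g x) := by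
  intro ε hε
  obtain ⟨K, hK, hfK⟩ := hf (ε / 2) (half_pos hε)
  obtain ⟨L, hL, hgL⟩ := hg (ε / 2) (half_pos hε)
  refine ⟨K ∪ L, hK.union hL, fun x hx => ?_⟩
  rw [Set.mem_union, not_or] at hx
  have := norm_add_le (f x) (g x)
  linarith [hfK x hx.1, hgL x hx.2]

end Vanish

variable [TopologicalSpace B] [TopologicalSpace (TotalSpace Unit A)]

/-- Continuity of a section of a bundle. -/
def IsContinuousSection (f : ∀ x, A x) : Prop :=
  Continuous fun x => (⟨x, f x⟩ : TotalSpace Unit A)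

/-- The continuous sections with compact support, `Γ_c`. -/
def IsCompactlySupportedSection (f : ∀ x, A x) : Prop :=
  IsContinuousSection f ∧ IsCompact (closure {x | f x ≠ 0})

variable [UscCStarBundle A]

theorem IsContinuousSection.zero : IsContinuousSection (fun x => (0 : A x)) := by
  refine continuous_iff_continuousAt.2 fun x => ?_
  refine UscCStarBundle.tendsto_zero _ x ?_ ?_
  · rw [tendsto_map'_iff]
    simp [Function.comp_def]
  · rw [tendsto_map'_iff]
    exact tendsto_id

theorem IsContinuousSection.add {f g : ∀ x, A x} (hf : IsContinuousSection f)
    (hg : IsContinuousSection g) : IsContinuousSection (fun x => f x + g x) := by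
  have h : Continuous fun x => (⟨x, (f x, g x)⟩ : TotalSpace (Unit × Unit) (A ×ᵇ A)) :=
    continuous_induced_rng.2 (Continuous.prodMk hf hg)
  exact UscCStarBundle.continuous_add.comp h

theorem IsContinuousSection.mul {f g : ∀ x, A x} (hf : IsContinuousSection f)
    (hg : IsContinuousSection g) : IsContinuousSection (fun x => f x * g x) := by
  have h : Continuous fun x => (⟨x, (f x, g x)⟩ : TotalSpace (Unit × Unit) (A ×ᵇ A)) :=
    continuous_induced_rng.2 (Continuous.prodMk hf hg)
  exact UscCStarBundle.continuous_mul.comp h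

theorem IsContinuousSection.smul {f : ∀ x, A x} (κ : ℂ) (hf : IsContinuousSection f) :
    IsContinuousSection (fun x => κ • f x) :=
  (UscCStarBundle.continuous_smul κ).comp hf

theorem IsContinuousSection.star {f : ∀ x, A x} (hf : IsContinuousSection f) :
    IsContinuousSection (fun x => star (f x)) :=
  UscCStarBundle.continuous_star.comp hf

variable (A)

/-- The algebra `Γ^b` of bounded continuous sections, with the supremum norm, inside the algebra
`lp A ∞` of all bounded sections. -/
def boundedSections : NonUnitalStarSubalgebra ℂ (lp A ∞) where
  carrier := {f | IsContinuousSection f}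
  zero_mem' := IsContinuousSection.zero
  add_mem' hf hg := IsContinuousSection.add hf hg
  mul_mem' hf hg := IsContinuousSection.mul hf hg
  smul_mem' κ _ hf := IsContinuousSection.smul κ hf
  star_mem' hf := IsContinuousSection.star hf

/-- The section algebra `Γ_0` of continuous sections that vanish at infinity. -/
def sectionAlgebra : NonUnitalStarSubalgebra ℂ (lp A ∞) where
  carrier := {f | IsContinuousSection f ∧ VanishesAtInfinityAlong (id : B → B) f}
  zero_mem' := ⟨IsContinuousSection.zero, VanishesAtInfinityAlong.zero⟩
  add_mem' hf hg := ⟨IsContinuousSection.add hf.1 hg.1, VanishesAtInfinityAlong.add hf.2 hg.2⟩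
  mul_mem' {f g} hf hg := ⟨IsContinuousSection.mul hf.1 hg.1, hg.2.of_le ‖f‖ fun x =>
    (norm_mul_le _ _).trans
      (mul_le_mul_of_nonneg_right (lp.norm_apply_le_norm (by simp) f x) (norm_nonneg _))⟩
  smul_mem' κ _ hf := ⟨IsContinuousSection.smul κ hf.1, hf.2.of_le ‖κ‖ fun x =>
    (norm_smul κ _).le⟩
  star_mem' hf := ⟨IsContinuousSection.star hf.1, hf.2.of_le 1 fun x => by simp⟩

variable {A}

theorem mul_mem_sectionAlgebra (f : boundedSections A) (c : sectionAlgebra A) :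
    (f : lp A ∞) * (c : lp A ∞) ∈ sectionAlgebra A :=
  ⟨IsContinuousSection.mul f.2 c.2.1, c.2.2.of_le ‖(f : lp A ∞)‖ fun x =>
    (norm_mul_le _ _).trans
      (mul_le_mul_of_nonneg_right (lp.norm_apply_le_norm (by simp) (f : lp A ∞) x)
        (norm_nonneg _))⟩

theorem mul_mem_sectionAlgebra' (f : boundedSections A) (c : sectionAlgebra A) :
    (c : lp A ∞) * (f : lp A ∞) ∈ sectionAlgebra A :=
  ⟨IsContinuousSection.mul c.2.1 f.2, c.2.2.of_le ‖(f : lp A ∞)‖ fun x =>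
    ((norm_mul_le _ _).trans
      (mul_le_mul_of_nonneg_left (lp.norm_apply_le_norm (by simp) (f : lp A ∞) x)
        (norm_nonneg _))).trans_eq (mul_comm _ _)⟩

instance : NormedStarGroup (sectionAlgebra A) := ⟨fun c => (norm_star (c : lp A ∞)).le⟩

/-- The inclusion of the bounded continuous sections in the multiplier algebra of the section
algebra: `f` acts on the left by `c ↦ f c` and on the right by `c ↦ c f`. -/
def toMultiplier : boundedSections A →⋆ₙₐ[ℂ] 𝓜(ℂ, sectionAlgebra A) where
  toFun f :=
    { fst := ((ContinuousLinearMap.mul ℂ (lp A ∞) (f : lp A ∞)).comp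
          (sectionAlgebra A).toSubmodule.subtypeL).codRestrict (sectionAlgebra A).toSubmodule
          (mul_mem_sectionAlgebra f)
      snd := (((ContinuousLinearMap.mul ℂ (lp A ∞)).flip (f : lp A ∞)).comp
          (sectionAlgebra A).toSubmodule.subtypeL).codRestrict (sectionAlgebra A).toSubmodule
          (mul_mem_sectionAlgebra' f)
      central := fun x y => Subtype.ext (mul_assoc (x : lp A ∞) f y) }
  map_smul' κ f := by
    ext c x
    · exact smul_mul_assoc κ ((f : lp A ∞) x) ((c : lp A ∞) x)
    · exact mul_smul_comm κ ((c : lp A ∞) x) ((f : lp A ∞) x)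
  map_zero' := by
    ext c x
    · exact zero_mul _
    · exact mul_zero _
  map_add' f g := by
    ext c x
    · exact add_mul _ _ _
    · exact mul_add _ _ _
  map_mul' f g := by
    ext c x
    · exact mul_assoc _ _ _
    · exact (mul_assoc _ _ _).symm
  map_star' f := by
    ext c x
    · rw [DoubleCentralizer.star_fst]
      have h := star_mul (star ((c : lp A ∞) x)) ((f : lp A ∞) x)
      rw [star_star] at h
      exact h.symm
    · rw [DoubleCentralizer.star_snd]
      have h := star_mul ((f : lp A ∞) x) (star ((c : lp A ∞) x))
      rw [star_star] at h
      exact h.symm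

end Sections

/-! ### Dynamical systems, the induced algebra and the generalized fixed point algebra -/

/-- A continuous action of the groupoid by `*`-isomorphisms (which preserve the norm) between the
fibres of a C⋆-bundle over its unit space.  The source of the map in `continuous_act` is the fibred
product of the arrows and the bundle over the unit space, i.e. the pullback of the bundle along the
source map. -/
structure DynamicalSystem [TopologicalSpace X] [TopologicalSpace (Arr X)] (A : X → Type w)
    [∀ x, NonUnitalCStarAlgebra (A x)] [TopologicalSpace (TotalSpace Unit A)] where
  /-- the isomorphism `α_γ : A(s(γ)) → A(r(γ))` -/
  act : ∀ {x y : X}, (x ⟶ y) → A x ≃⋆ₐ[ℂ] A y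
  act_mul : ∀ {x y z : X} (η : x ⟶ y) (γ : y ⟶ z) (a : A x),
    act (η ≫ γ) a = act γ (act η a)
  continuous_act : Continuous fun p : TotalSpace Unit ((Arr.src : Arr X → X) *ᵖ A) =>
    (⟨p.proj.tgt, act p.proj.hom p.snd⟩ : TotalSpace Unit A)

section Dynamics

variable [TopologicalSpace X] [TopologicalSpace (Arr X)] {A : X → Type w}
  [∀ x, NonUnitalCStarAlgebra (A x)] [TopologicalSpace (TotalSpace Unit A)]

/-- The induced algebra: bounded continuous sections `f` with `f(r(γ)) = α_γ(f(s(γ)))` for all `γ`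
such that `E · u ↦ ‖f(u)‖` vanishes at infinity on the orbit space. -/
def inducedAlgebra [UscCStarBundle A] (α : DynamicalSystem A) :
    NonUnitalStarSubalgebra ℂ (boundedSections A) where
  carrier := {f | (∀ γ : Arr X, (f : lp A ∞) γ.tgt = α.act γ.hom ((f : lp A ∞) γ.src)) ∧
    VanishesAtInfinityAlong (orbit : X → OrbitSpace X) (f : lp A ∞)}
  zero_mem' := ⟨fun γ => (map_zero (α.act γ.hom)).symm, VanishesAtInfinityAlong.zero⟩
  add_mem' {f g} hf hg := ⟨fun γ => by
    have h := map_add (α.act γ.hom) ((f : lp A ∞) γ.src) ((g : lp A ∞) γ.src)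
    rw [← hf.1 γ, ← hg.1 γ] at h
    exact h.symm, VanishesAtInfinityAlong.add hf.2 hg.2⟩
  mul_mem' {f g} hf hg := ⟨fun γ => by
    have h := map_mul (α.act γ.hom) ((f : lp A ∞) γ.src) ((g : lp A ∞) γ.src)
    rw [← hf.1 γ, ← hg.1 γ] at h
    exact h.symm, hg.2.of_le ‖(f : lp A ∞)‖ fun x => (norm_mul_le _ _).trans
      (mul_le_mul_of_nonneg_right (lp.norm_apply_le_norm (by simp) (f : lp A ∞) x)
        (norm_nonneg _))⟩
  smul_mem' κ f hf := ⟨fun γ => by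
    have h := map_smul (α.act γ.hom) κ ((f : lp A ∞) γ.src)
    rw [← hf.1 γ] at h
    exact h.symm, hf.2.of_le ‖κ‖ fun x => (norm_smul κ _).le⟩
  star_mem' {f} hf := ⟨fun γ => by
    have h := map_star (α.act γ.hom) ((f : lp A ∞) γ.src)
    rw [← hf.1 γ] at h
    exact h.symm, hf.2.of_le 1 fun x => by simp⟩

open Classical in
/-- The function `γ ↦ α_γ(h(s(γ)))` on the arrows of range `u`, with values in `A(u)`; it is
extended by zero to all arrows. -/
def orbitFunction (α : DynamicalSystem A) (h : ∀ x, A x) (u : X) (γ : Arr X) : A u :=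
  if hγ : γ.tgt = u then hγ ▸ α.act γ.hom (h γ.src) else 0

/-- `λ(h)(u) = ∫ α_γ(h(s(γ))) dλ^u(γ)`. -/
def orbitIntegral [MeasurableSpace (Arr X)] (H : HaarSystem X) (α : DynamicalSystem A)
    (h : ∀ x, A x) (u : X) : A u :=
  ∫ γ, orbitFunction α h u γ ∂H.measure u

/-- The generalized fixed point algebra: the closed linear span, in the multiplier algebra of the
section algebra, of the bounded continuous sections `λ(a⋆b)` with `a` and `b` in `Γ_c`. -/
def fixedPointAlgebra [MeasurableSpace (Arr X)] [UscCStarBundle A] (H : HaarSystem X)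
    (α : DynamicalSystem A) : Submodule ℂ 𝓜(ℂ, sectionAlgebra A) :=
  (Submodule.span ℂ {m | ∃ (a b : ∀ x, A x) (f : boundedSections A),
    IsCompactlySupportedSection a ∧ IsCompactlySupportedSection b ∧
      (∀ u, (f : lp A ∞) u = orbitIntegral H α (fun x => star (a x) * b x) u) ∧
      m = toMultiplier f}).topologicalClosure

end Dynamics

end GroupoidFix

end

open GroupoidFix

/-! For `h` in Γ_c, left invariance makes λ(h) equivariant (`orbitIntegral_tgt`), and λ(h) vanishes
off the orbits that meet the support of `h`; so λ(h) lies in Ind once it is continuous. Continuity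
(`isContinuousSection_orbitIntegral`) is the delicate point, because norms are only upper
semicontinuous; the argument uses no continuous section through a prescribed point. It rests on the
local criterion `OscLT`, which compares a section with nearby points of the total space, and on a
partition of unity on the arrows that makes γ ↦ α_γ(h(s(γ))) almost constant on each piece. Since
Ind is closed and Γ^b embeds isometrically in M(A), Fix ⊆ Ind follows.

Conversely, Ind is a C⋆-algebra, hence spanned by its elements b⋆b, and
`exists_orbitIntegral_approx` approximates each of them by some λ(c⋆c). Take a compact L whose
orbits contain every point where ‖b⋆b‖ ≥ ε, a cut-off w ≥ 0 in C_c equal to 1 on L, and W(u) = ∫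
w(s(γ)) dλ^u(γ), which is continuous, constant on orbits and bounded below by some m > 0 on the
orbits of L. For c = √(w/(W+δ)) b, equivariance gives λ(c⋆c) = W/(W+δ) b⋆b. The error δ/(W+δ) b⋆b is
uniformly small: on the orbits of L because W ≥ m, elsewhere because b⋆b is small there and the
factor is at most 1. -/

noncomputable section

namespace GroupoidFix

universe u v w

set_option linter.unusedSectionVars false

/-! ### Convergence in the total space of a bundle -/

section FibredSquare

variable {B : Type u} {A : B → Type w} [TopologicalSpace (TotalSpace Unit A)]

theorem tendsto_prod_total {T : Type*} {l : Filter T} {b : T → B} {f g : ∀ t, A (b t)} {x : B}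
    {a c : A x} (hf : Tendsto (fun t => (⟨b t, f t⟩ : TotalSpace Unit A)) l (𝓝 ⟨x, a⟩))
    (hg : Tendsto (fun t => (⟨b t, g t⟩ : TotalSpace Unit A)) l (𝓝 ⟨x, c⟩)) :
    Tendsto (fun t => (⟨b t, (f t, g t)⟩ : TotalSpace (Unit × Unit) (A ×ᵇ A))) l
      (𝓝 ⟨x, (a, c)⟩) := by
  rw [nhds_induced, tendsto_comap_iff]
  exact hf.prodMk_nhds hg

theorem tendsto_fst_prod {x : B} (a c : A x) :
    Tendsto (fun p : TotalSpace (Unit × Unit) (A ×ᵇ A) =>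
      (⟨p.proj, p.snd.1⟩ : TotalSpace Unit A)) (𝓝 ⟨x, (a, c)⟩) (𝓝 ⟨x, a⟩) := by
  rw [nhds_induced]
  exact (continuous_fst.tendsto _).comp tendsto_comap

theorem tendsto_snd_prod {x : B} (a c : A x) :
    Tendsto (fun p : TotalSpace (Unit × Unit) (A ×ᵇ A) =>
      (⟨p.proj, p.snd.2⟩ : TotalSpace Unit A)) (𝓝 ⟨x, (a, c)⟩) (𝓝 ⟨x, c⟩) := by
  rw [nhds_induced]
  exact (continuous_snd.tendsto _).comp tendsto_comap

end FibredSquare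

section BundleTopology

variable {B : Type u} [TopologicalSpace B] {A : B → Type w} [∀ x, NonUnitalCStarAlgebra (A x)]
  [TopologicalSpace (TotalSpace Unit A)] [UscCStarBundle A]

theorem tendsto_proj_of_tendsto {T : Type*} {l : Filter T} {z : T → TotalSpace Unit A}
    {z₀ : TotalSpace Unit A} (h : Tendsto z l (𝓝 z₀)) :
    Tendsto (fun t => (z t).proj) l (𝓝 z₀.proj) :=
  (UscCStarBundle.continuous_proj (A := A)).continuousAt.tendsto.comp h

theorem tendsto_add {T : Type*} {l : Filter T} {b : T → B} {f g : ∀ t, A (b t)} {x : B}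
    {a c : A x} (hf : Tendsto (fun t => (⟨b t, f t⟩ : TotalSpace Unit A)) l (𝓝 ⟨x, a⟩))
    (hg : Tendsto (fun t => (⟨b t, g t⟩ : TotalSpace Unit A)) l (𝓝 ⟨x, c⟩)) :
    Tendsto (fun t => (⟨b t, f t + g t⟩ : TotalSpace Unit A)) l (𝓝 ⟨x, a + c⟩) :=
  ((UscCStarBundle.continuous_add (A := A)).tendsto ⟨x, (a, c)⟩).comp (tendsto_prod_total hf hg)

theorem tendsto_const_smul {T : Type*} {l : Filter T} {b : T → B} {f : ∀ t, A (b t)} {x : B}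
    {a : A x} (κ : ℂ) (hf : Tendsto (fun t => (⟨b t, f t⟩ : TotalSpace Unit A)) l (𝓝 ⟨x, a⟩)) :
    Tendsto (fun t => (⟨b t, κ • f t⟩ : TotalSpace Unit A)) l (𝓝 ⟨x, κ • a⟩) :=
  ((UscCStarBundle.continuous_smul (A := A) κ).tendsto ⟨x, a⟩).comp hf

theorem tendsto_sub {T : Type*} {l : Filter T} {b : T → B} {f g : ∀ t, A (b t)} {x : B}
    {a c : A x} (hf : Tendsto (fun t => (⟨b t, f t⟩ : TotalSpace Unit A)) l (𝓝 ⟨x, a⟩))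
    (hg : Tendsto (fun t => (⟨b t, g t⟩ : TotalSpace Unit A)) l (𝓝 ⟨x, c⟩)) :
    Tendsto (fun t => (⟨b t, f t - g t⟩ : TotalSpace Unit A)) l (𝓝 ⟨x, a - c⟩) := by
  have := tendsto_add hf (tendsto_const_smul (-1) hg)
  simpa only [neg_smul, one_smul, ← sub_eq_add_neg] using this

theorem tendsto_of_norm_tendsto_zero {T : Type*} {l : Filter T} {b : T → B} {f : ∀ t, A (b t)}
    {x : B} (hf : Tendsto (fun t => ‖f t‖) l (𝓝 0)) (hb : Tendsto b l (𝓝 x)) :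
    Tendsto (fun t => (⟨b t, f t⟩ : TotalSpace Unit A)) l (𝓝 ⟨x, 0⟩) := by
  refine UscCStarBundle.tendsto_zero _ x ?_ ?_
  · rwa [tendsto_map'_iff]
  · rwa [tendsto_map'_iff]

theorem eventually_norm_lt {T : Type*} {l : Filter T} {b : T → B} {f : ∀ t, A (b t)} {x : B}
    {a : A x} (hf : Tendsto (fun t => (⟨b t, f t⟩ : TotalSpace Unit A)) l (𝓝 ⟨x, a⟩)) {r : ℝ}
    (hr : ‖a‖ < r) : ∀ᶠ t in l, ‖f t‖ < r :=
  hf.eventually (UscCStarBundle.upperSemicontinuous_norm (A := A) ⟨x, a⟩ r hr)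

/-- The bundle axioms give continuity for a fixed scalar only. Upper semicontinuity bounds ‖f t‖
eventually, so the correction (κ t - κ₀) • f t tends to zero in norm, hence in the total space. -/
theorem tendsto_smul {T : Type*} {l : Filter T} {b : T → B} {f : ∀ t, A (b t)} {x : B}
    {a : A x} {κ : T → ℂ} {κ₀ : ℂ} (hκ : Tendsto κ l (𝓝 κ₀))
    (hf : Tendsto (fun t => (⟨b t, f t⟩ : TotalSpace Unit A)) l (𝓝 ⟨x, a⟩)) :
    Tendsto (fun t => (⟨b t, κ t • f t⟩ : TotalSpace Unit A)) l (𝓝 ⟨x, κ₀ • a⟩) := by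
  have h0 : Tendsto (fun t => ‖(κ t - κ₀) • f t‖) l (𝓝 0) := by
    have h1 : Tendsto (fun t => ‖κ t - κ₀‖ * (‖a‖ + 1)) l (𝓝 0) := by
      have : Tendsto (fun t => ‖κ t - κ₀‖) l (𝓝 0) := tendsto_iff_norm_sub_tendsto_zero.1 hκ
      simpa using this.mul_const (‖a‖ + 1)
    refine squeeze_zero' (Eventually.of_forall fun t => norm_nonneg _) ?_ h1
    filter_upwards [eventually_norm_lt hf (lt_add_one ‖a‖)] with t ht
    rw [norm_smul]
    exact mul_le_mul_of_nonneg_left ht.le (norm_nonneg _)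
  have := tendsto_add (tendsto_const_smul κ₀ hf)
    (tendsto_of_norm_tendsto_zero h0 (tendsto_proj_of_tendsto hf))
  simpa [← add_smul] using this

theorem tendsto_fibre {T : Type*} {l : Filter T} {x : B} {f : T → A x} {a : A x}
    (hf : Tendsto (fun t => (⟨x, f t⟩ : TotalSpace Unit A)) l (𝓝 ⟨x, a⟩)) :
    Tendsto f l (𝓝 a) := by
  rw [tendsto_iff_norm_sub_tendsto_zero, Metric.tendsto_nhds]
  intro ε hε
  have hc : Tendsto (fun _ : T => (⟨x, a⟩ : TotalSpace Unit A)) l (𝓝 ⟨x, a⟩) := tendsto_const_nhds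
  filter_upwards [eventually_norm_lt (tendsto_sub hf hc) (r := ε) (by simpa using hε)] with t ht
  simpa using ht

/-- The function (a, c) ↦ ‖a - c‖ on the fibred square is upper semicontinuous and vanishes on the
diagonal. As the square carries the topology induced from the product, a neighbourhood of a diagonal
point contains the trace of some U × U. -/
theorem exists_nhds_norm_sub_lt (y : TotalSpace Unit A) {ε : ℝ} (hε : 0 < ε) :
    ∃ U : Set (TotalSpace Unit A), IsOpen U ∧ y ∈ U ∧ ∀ (x : B) (a c : A x),
      (⟨x, a⟩ : TotalSpace Unit A) ∈ U → (⟨x, c⟩ : TotalSpace Unit A) ∈ U → ‖a - c‖ < ε := by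
  obtain ⟨x₀, a₀⟩ := y
  have h := eventually_norm_lt (tendsto_sub (tendsto_fst_prod a₀ a₀) (tendsto_snd_prod a₀ a₀))
    (r := ε) (by simpa using hε)
  rw [nhds_induced, eventually_comap, nhds_prod_eq] at h
  obtain ⟨U, hU, h⟩ := (eventually_prod_self_iff (la := 𝓝 (⟨x₀, a₀⟩ : TotalSpace Unit A))
    (r := fun y z => ∀ p : TotalSpace (Unit × Unit) (A ×ᵇ A),
      ((⟨p.proj, p.snd.1⟩, ⟨p.proj, p.snd.2⟩) : TotalSpace Unit A × TotalSpace Unit A) = (y, z) →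
        ‖p.snd.1 - p.snd.2‖ < ε)).1 h
  obtain ⟨V, hVU, hV, hyV⟩ := mem_nhds_iff.1 hU
  exact ⟨V, hV, hyV, fun x a c ha hc => h _ (hVU ha) _ (hVU hc) ⟨x, (a, c)⟩ rfl⟩

/-- The first projection of the fibred square of the total space is open. -/
theorem nhds_le_map_fst {x : B} (a c : A x) :
    𝓝 (⟨x, a⟩ : TotalSpace Unit A) ≤ map (fun p : TotalSpace (Unit × Unit) (A ×ᵇ A) =>
      (⟨p.proj, p.snd.1⟩ : TotalSpace Unit A)) (𝓝 ⟨x, (a, c)⟩) := by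
  rw [le_map_iff]
  intro S hS
  rw [nhds_induced, mem_comap] at hS
  obtain ⟨V, hV, hVS⟩ := hS
  obtain ⟨V₁, hV₁, V₂, hV₂, hV⟩ := mem_nhds_prod_iff.1 hV
  -- Openness of the projection supplies, over every base point close to x, a second coordinate in
  -- `V₂`.
  have h2 := (UscCStarBundle.isOpenMap_proj (A := A)).image_mem_nhds hV₂
  filter_upwards [hV₁, (UscCStarBundle.continuous_proj (A := A)).continuousAt.preimage_mem_nhds h2]
    with z hz hz2
  obtain ⟨⟨y, d⟩, hd, hyd⟩ := hz2
  obtain ⟨y', e⟩ := z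
  obtain rfl : y = y' := hyd
  exact ⟨⟨y, (e, d)⟩, hVS (hV ⟨hz, hd⟩), rfl⟩

/-- The graph of `g` stays within `ε` of every local continuation of `g x`. -/
def OscLT (g : ∀ x, A x) (x : B) (ε : ℝ) : Prop :=
  ∀ᶠ z in 𝓝 (⟨x, g x⟩ : TotalSpace Unit A), ‖g z.proj - z.snd‖ < ε

/-- For z near ⟨x, g x⟩, the value of g over z.proj is z plus a vector of small norm, so it tends to
g x. This limit is along points of the total space; it descends to the base because the projection
is continuous and open, so that 𝓝 x is the image of 𝓝 ⟨x, g x⟩. -/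
theorem continuousAt_of_oscLT {g : ∀ x, A x} {x : B} (h : ∀ ε : ℝ, 0 < ε → OscLT g x ε) :
    ContinuousAt (fun x => (⟨x, g x⟩ : TotalSpace Unit A)) x := by
  have h1 : Tendsto (fun z : TotalSpace Unit A => ‖g z.proj - z.snd‖) (𝓝 ⟨x, g x⟩) (𝓝 0) := by
    rw [Metric.tendsto_nhds]
    intro ε hε
    filter_upwards [h ε hε] with z hz
    simpa using hz
  have h2 : Tendsto (fun z : TotalSpace Unit A => (⟨z.proj, z.snd⟩ : TotalSpace Unit A))
    (𝓝 ⟨x, g x⟩) (𝓝 ⟨x, g x⟩) := tendsto_id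
  have h3 := tendsto_add h2 (tendsto_of_norm_tendsto_zero h1 (tendsto_proj_of_tendsto h2))
  simp only [add_sub_cancel, add_zero] at h3
  rw [ContinuousAt]
  have h4 : 𝓝 x = map TotalSpace.proj (𝓝 (⟨x, g x⟩ : TotalSpace Unit A)) :=
    ((UscCStarBundle.isOpenMap_proj (A := A)).nhds_le ⟨x, g x⟩).antisymm
      ((UscCStarBundle.continuous_proj (A := A)).tendsto _)
  rw [h4, tendsto_map'_iff]
  exact h3

theorem OscLT.congr {g g' : ∀ x, A x} {x : B} {ε : ℝ} (h : OscLT g x ε)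
    (hg : ∀ᶠ y in 𝓝 x, g' y = g y) : OscLT g' x ε := by
  unfold OscLT at h ⊢
  rw [hg.self_of_nhds]
  filter_upwards [h, (UscCStarBundle.continuous_proj (A := A)).continuousAt.eventually hg]
    with z hz hz'
  rwa [hz']

theorem oscLT_zero {x : B} {ε : ℝ} (hε : 0 < ε) : OscLT (fun x => (0 : A x)) x ε := by
  have := UscCStarBundle.upperSemicontinuous_norm (A := A) ⟨x, 0⟩ ε (by simpa using hε)
  filter_upwards [this] with z hz
  simpa using hz

/-- A point near f x + g x does not split by itself. Passing to the fibred square adds a second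
coordinate near f x, and the difference of the two coordinates is then near g x. -/
theorem OscLT.add {f g : ∀ x, A x} {x : B} {ε δ : ℝ} (hf : OscLT f x ε) (hg : OscLT g x δ) :
    OscLT (fun x => f x + g x) x (ε + δ) := by
  refine nhds_le_map_fst (f x + g x) (f x) ?_
  have h1 := tendsto_fst_prod (f x + g x) (f x)
  have h2 := tendsto_snd_prod (f x + g x) (f x)
  have h3 := tendsto_sub h1 h2
  rw [add_sub_cancel_left] at h3
  rw [mem_map]
  filter_upwards [h2.eventually hf, h3.eventually hg] with p hp hp'
  calc ‖f p.proj + g p.proj - p.snd.1‖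
      = ‖(f p.proj - p.snd.2) + (g p.proj - (p.snd.1 - p.snd.2))‖ := by congr 1; abel
    _ ≤ _ := norm_add_le _ _
    _ < ε + δ := add_lt_add hp hp'

/-- The slack δ pays for the empty sum: `OscLT` is a strict inequality and fails with bound 0. -/
theorem OscLT.sum {ι : Type*} (s : Finset ι) {g : ι → ∀ x, A x} {x : B} {ε : ι → ℝ}
    (h : ∀ i ∈ s, OscLT (g i) x (ε i)) {δ : ℝ} (hδ : 0 < δ) :
    OscLT (fun x => ∑ i ∈ s, g i x) x (∑ i ∈ s, ε i + δ) := by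
  classical
  induction s using Finset.induction_on with
  | empty => simpa using oscLT_zero hδ
  | insert i s hi ih =>
    have := (h i (Finset.mem_insert_self i s)).add
      (ih fun j hj => h j (Finset.mem_insert_of_mem hj))
    simpa only [Finset.sum_insert hi, add_assoc] using this

/-- Auxiliary points d near c stand in for a local section: both g and any z near g x lie within
about ε w of w • d, the first by hypothesis, the second by upper semicontinuity starting from the
estimate at x. Hence the factor 2. -/
theorem oscLT_of_norm_sub_smul_le {g : ∀ x, A x} {x : B} {w : B → ℝ} (hw : ContinuousAt w x)
    {U : Set (TotalSpace Unit A)} (hU : IsOpen U) {c : A x} (hc : (⟨x, c⟩ : TotalSpace Unit A) ∈ U)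
    {ε : ℝ} (h : ∀ y (d : A y), (⟨y, d⟩ : TotalSpace Unit A) ∈ U →
      ‖g y - (w y : ℂ) • d‖ ≤ ε * w y) {δ : ℝ} (hδ : 0 < δ) :
    OscLT g x (2 * ε * w x + δ) := by
  refine nhds_le_map_fst (g x) c ?_
  have h1 := tendsto_fst_prod (g x) c
  have h2 := tendsto_snd_prod (g x) c
  have hw' := hw.tendsto.comp (tendsto_proj_of_tendsto h1)
  have h3 := tendsto_sub h1
    (tendsto_smul ((Complex.continuous_ofReal.tendsto _).comp hw') h2)
  have h4 := eventually_norm_lt h3 (r := ε * w x + δ / 2) (by linarith [h x c hc])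
  have h5 : ∀ᶠ p in 𝓝 (⟨x, (g x, c)⟩ : TotalSpace (Unit × Unit) (A ×ᵇ A)),
      ε * w p.proj < ε * w x + δ / 2 :=
    (hw'.const_mul ε).eventually_lt_const (by simp; linarith)
  rw [mem_map]
  filter_upwards [h4, h5, h2.eventually (hU.mem_nhds hc)] with p hp hp' hpU
  have h6 := h p.proj p.snd.2 hpU
  simp only [Function.comp_apply] at hp
  calc ‖g p.proj - p.snd.1‖
      = ‖(g p.proj - (w p.proj : ℂ) • p.snd.2) - (p.snd.1 - (w p.proj : ℂ) • p.snd.2)‖ := by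
        congr 1; abel
    _ ≤ _ := norm_sub_le _ _
    _ < 2 * ε * w x + δ := by linarith

/-- A section that is uniformly approximated by continuous sections is continuous. -/
theorem isContinuousSection_of_approx {f : ∀ x, A x}
    (h : ∀ ε : ℝ, 0 < ε → ∃ g : ∀ x, A x, IsContinuousSection g ∧ ∀ x, ‖f x - g x‖ < ε) :
    IsContinuousSection f := by
  refine continuous_iff_continuousAt.2 fun x => continuousAt_of_oscLT fun ε hε => ?_
  obtain ⟨g, hg, hfg⟩ := h (ε / 2) (half_pos hε)
  have h1 : Tendsto (fun z : TotalSpace Unit A => (⟨z.proj, z.snd⟩ : TotalSpace Unit A))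
    (𝓝 ⟨x, f x⟩) (𝓝 ⟨x, f x⟩) := tendsto_id
  have h2 : Tendsto (fun z : TotalSpace Unit A => (⟨z.proj, g z.proj⟩ : TotalSpace Unit A))
    (𝓝 ⟨x, f x⟩) (𝓝 ⟨x, g x⟩) := (hg.tendsto x).comp (tendsto_proj_of_tendsto h1)
  filter_upwards [eventually_norm_lt (tendsto_sub h1 h2) (hfg x)] with z hz
  calc ‖f z.proj - z.snd‖ = ‖(f z.proj - g z.proj) - (z.snd - g z.proj)‖ := by congr 1; abel
    _ ≤ _ := norm_sub_le _ _
    _ < ε := by linarith [hfg z.proj]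

theorem IsContinuousSection.smul_fun {f : ∀ x, A x} (hf : IsContinuousSection f) {κ : B → ℂ}
    (hκ : Continuous κ) : IsContinuousSection (fun x => κ x • f x) :=
  continuous_iff_continuousAt.2 fun x => tendsto_smul (hκ.tendsto x) (hf.tendsto x)

end BundleTopology

variable {X : Type u} [Groupoid.{v} X]

/-! ### Topological groupoids with a Haar system -/

namespace Arr

theorem mul_inv_self (γ : Arr X) : γ.mul γ.inv rfl = unit γ.tgt := by
  simp [mul, inv, unit]

open Classical in
/-- Left translation by `η`, with a junk value off the arrows of range `s(η)`. -/
def translate (η γ : Arr X) : Arr X := if h : η.src = γ.tgt then η.mul γ h else η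

theorem translate_of_eq {η γ : Arr X} (h : η.src = γ.tgt) : η.translate γ = η.mul γ h :=
  dif_pos h

end Arr

section TopologicalGroupoid

variable [TopologicalSpace X] [TopologicalSpace (Arr X)] [TopologicalGroupoid X]

theorem continuous_unit : Continuous (Arr.unit : X → Arr X) :=
  TopologicalGroupoid.isInducing_unit.continuous

/-- The unit at r(γ) is γγ⁻¹, and the units carry the induced topology. -/
theorem continuous_tgt : Continuous (Arr.tgt : Arr X → X) := by
  rw [TopologicalGroupoid.isInducing_unit.continuous_iff]
  have h : Continuous fun γ : Arr X => (⟨(γ, γ.inv), rfl⟩ : {p : Arr X × Arr X // p.1.src = p.2.tgt}) :=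
    (continuous_id.prodMk TopologicalGroupoid.continuous_inv).subtype_mk _
  exact (TopologicalGroupoid.continuous_mul.comp h).congr fun γ => γ.mul_inv_self

theorem continuous_src : Continuous (Arr.src : Arr X → X) :=
  continuous_tgt.comp TopologicalGroupoid.continuous_inv

theorem isEmbedding_unit : IsEmbedding (Arr.unit : X → Arr X) :=
  ⟨TopologicalGroupoid.isInducing_unit, fun _ _ h => congrArg Arr.src h⟩

theorem isClosedEmbedding_unit [T2Space (Arr X)] : IsClosedEmbedding (Arr.unit : X → Arr X) := by
  refine ⟨isEmbedding_unit, ?_⟩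
  have : Set.range (Arr.unit : X → Arr X) = {γ | Arr.unit γ.src = γ} := by
    ext γ
    exact ⟨fun ⟨x, hx⟩ => by subst hx; rfl, fun h => ⟨_, h⟩⟩
  rw [this]
  exact isClosed_eq (continuous_unit.comp continuous_src) continuous_id

theorem t2Space_units [T2Space (Arr X)] : T2Space X := isEmbedding_unit.t2Space

theorem locallyCompactSpace_units [T2Space (Arr X)] [LocallyCompactSpace (Arr X)] :
    LocallyCompactSpace X := isClosedEmbedding_unit.locallyCompactSpace

theorem continuousOn_translate (η : Arr X) :
    ContinuousOn η.translate {γ | γ.tgt = η.src} := by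
  rw [continuousOn_iff_continuous_domRestrict]
  have h : Continuous fun γ : {γ : Arr X | γ.tgt = η.src} =>
      (⟨(η, γ), γ.2.symm⟩ : {p : Arr X × Arr X // p.1.src = p.2.tgt}) :=
    (continuous_const.prodMk continuous_subtype_val).subtype_mk _
  exact (TopologicalGroupoid.continuous_mul.comp h).congr fun γ =>
    (Arr.translate_of_eq (Eq.symm γ.2)).symm

theorem isClosed_tgt_eq [T2Space (Arr X)] (u : X) : IsClosed {γ : Arr X | γ.tgt = u} :=
  have := t2Space_units (X := X)
  isClosed_eq continuous_tgt continuous_const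

theorem isCompact_src_tgt [T2Space (Arr X)] (hproper : IsProperGroupoid X) {K : Set X}
    (hK : IsCompact K) (u : X) : IsCompact {γ : Arr X | γ.src ∈ K ∧ γ.tgt = u} := by
  simpa using hproper K {u} hK isCompact_singleton

end TopologicalGroupoid

/-! ### Consequences of the Haar system: open range map, orbit space, translation of measures -/

section Haar

variable [TopologicalSpace X] [TopologicalSpace (Arr X)] [TopologicalGroupoid X]
  [SecondCountableTopology (Arr X)] [LocallyCompactSpace (Arr X)] [T2Space (Arr X)]
  [MeasurableSpace (Arr X)] [BorelSpace (Arr X)]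

instance (H : HaarSystem X) (u : X) : IsFiniteMeasureOnCompacts (H.measure u) := H.finite_on_compacts u

theorem HaarSystem.ae_tgt (H : HaarSystem X) (u : X) : ∀ᵐ γ ∂H.measure u, γ.tgt = u := by
  have := Measure.support_mem_ae (μ := H.measure u)
  rwa [H.support_eq] at this

theorem HaarSystem.continuous_integral_real (H : HaarSystem X) {f : Arr X → ℝ} (hf : Continuous f)
    (hc : HasCompactSupport f) : Continuous fun u => ∫ γ, f γ ∂H.measure u := by
  have h := H.continuous_integral (fun γ => (f γ : ℂ)) (Complex.continuous_ofReal.comp hf)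
    (hc.comp_left (g := fun t : ℝ => (t : ℂ)) Complex.ofReal_zero)
  simp only [integral_complex_ofReal] at h
  exact (Complex.continuous_re.comp h).congr fun u => by simp

theorem HaarSystem.integral_pos (H : HaarSystem X) {u : X} {f : Arr X → ℝ} (hf : Continuous f) (h0 : ∀ γ, 0 ≤ f γ)
    (hi : Integrable f (H.measure u)) {γ : Arr X} (hγ : γ.tgt = u) (hpos : 0 < f γ) :
    0 < ∫ γ, f γ ∂H.measure u := by
  rw [integral_pos_iff_support_of_nonneg h0 hi]
  have : γ ∈ (H.measure u).support := by rw [H.support_eq]; exact hγ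
  exact (Measure.mem_support_iff_forall γ).1 this _
    ((isOpen_ne_fun hf continuous_const).mem_nhds hpos.ne')

/-- A bump function at γ inside the open set has positive λ^{r(γ)}-integral by full support. The
integral stays positive for u near r(γ), so the open set still meets the arrows of range u. -/
theorem isOpenMap_tgt (H : HaarSystem X) : IsOpenMap (Arr.tgt : Arr X → X) := by
  refine IsOpenMap.of_nhds_le fun γ S hS => ?_
  obtain ⟨V, hVS, hV, hγV⟩ := mem_nhds_iff.1 hS
  obtain ⟨f, hf1, hf0, hfc, hf⟩ := exists_continuous_one_zero_of_isCompact
    (isCompact_singleton (x := γ)) hV.isClosed_compl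
    (Set.disjoint_compl_right_iff_subset.2 (Set.singleton_subset_iff.2 hγV))
  have hpos := H.integral_pos (u := γ.tgt) f.continuous (fun γ => (hf γ).1)
    (f.continuous.integrable_of_hasCompactSupport hfc) rfl (by rw [hf1 rfl]; exact one_pos)
  have hcont := H.continuous_integral_real f.continuous hfc
  filter_upwards [hcont.continuousAt.eventually (lt_mem_nhds hpos)] with u hu
  by_contra hcon
  refine hu.ne' (integral_eq_zero_of_ae ?_)
  filter_upwards [H.ae_tgt u] with γ' hγ'
  refine hf0 fun hV' => hcon ?_
  rw [← hγ']
  exact hVS hV'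

theorem orbit_tgt_eq (γ : Arr X) : orbit γ.tgt = orbit γ.src :=
  Quotient.sound ⟨Groupoid.inv γ.hom⟩

theorem exists_arr_of_orbit_eq {x y : X} (h : orbit x = orbit y) :
    ∃ γ : Arr X, γ.src = x ∧ γ.tgt = y :=
  let ⟨γ⟩ := Quotient.exact h
  ⟨⟨x, y, γ⟩, rfl, rfl⟩

theorem isOpenMap_orbit (H : HaarSystem X) : IsOpenMap (orbit : X → OrbitSpace X) := by
  intro U hU
  have h : (orbit : X → OrbitSpace X) ⁻¹' (orbit '' U) = Arr.tgt '' (Arr.src ⁻¹' U) := by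
    ext y
    constructor
    · rintro ⟨x, hx, hxy⟩
      obtain ⟨γ, rfl, rfl⟩ := exists_arr_of_orbit_eq hxy
      exact ⟨γ, hx, rfl⟩
    · rintro ⟨γ, hγ, rfl⟩
      exact ⟨γ.src, hγ, (orbit_tgt_eq γ).symm⟩
  refine isOpen_coinduced.2 ?_
  exact h ▸ isOpenMap_tgt H _ (hU.preimage continuous_src)

theorem continuous_orbit : Continuous (orbit : X → OrbitSpace X) := continuous_quotient_mk'

theorem exists_isCompact_subset_image_orbit (H : HaarSystem X) {K : Set (OrbitSpace X)}
    (hK : IsCompact K) : ∃ L : Set X, IsCompact L ∧ K ⊆ orbit '' L := by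
  have := locallyCompactSpace_units (X := X)
  choose N hN hN' using fun x : X => exists_compact_mem_nhds x
  obtain ⟨t, ht⟩ := hK.elim_finite_subcover (fun x : X => orbit '' interior (N x))
    (fun x => isOpenMap_orbit H _ isOpen_interior) (fun o _ => by
      obtain ⟨x, rfl⟩ := Quotient.exists_rep o
      exact Set.mem_iUnion.2 ⟨x, x, mem_interior_iff_mem_nhds.2 (hN' x), rfl⟩)
  refine ⟨⋃ x ∈ t, N x, t.isCompact_biUnion fun x _ => hN x, ht.trans ?_⟩
  simp only [Set.image_iUnion]
  exact Set.iUnion₂_mono fun x _ => Set.image_mono interior_subset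

theorem HaarSystem.aemeasurable_translate (H : HaarSystem X) (η : Arr X) :
    AEMeasurable η.translate (H.measure η.src) := by
  have h := (continuousOn_translate η).aemeasurable (μ := H.measure η.src)
    (isClosed_tgt_eq η.src).measurableSet
  rwa [Measure.restrict_eq_self_of_ae_mem (s := {γ : Arr X | γ.tgt = η.src}) (H.ae_tgt η.src)] at h

/-- Invariance is assumed on C_c only; equality of the measures extends it to vector-valued
integrands and to functions w ∘ s. -/
theorem HaarSystem.map_translate (H : HaarSystem X) (hproper : IsProperGroupoid X) (η : Arr X) :
    (H.measure η.src).map η.translate = H.measure η.tgt := by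
  have : IsFiniteMeasureOnCompacts ((H.measure η.src).map η.translate) := by
    refine ⟨fun K hK => ?_⟩
    rw [Measure.map_apply_of_aemeasurable (H.aemeasurable_translate η) hK.measurableSet]
    -- Left translation preserves sources, so the preimage of K lies, up to a null set, among the
    -- arrows from s(K) to s(η), a compact set by properness.
    have hC := isCompact_src_tgt hproper (hK.image continuous_src) η.src
    refine (measure_mono_ae ?_).trans_lt hC.measure_lt_top
    filter_upwards [H.ae_tgt η.src] with γ hγ hγK
    refine ⟨⟨η.translate γ, hγK, ?_⟩, hγ⟩
    rw [Arr.translate_of_eq hγ.symm]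
    rfl
  refine Measure.ext_of_integral_eq_on_compactlySupported fun f => ?_
  refine (integral_map (H.aemeasurable_translate η) f.continuous.aestronglyMeasurable).trans ?_
  have h := H.left_invariant η (fun γ => (f γ : ℂ)) (Complex.continuous_ofReal.comp f.continuous)
    (f.hasCompactSupport.comp_left (g := fun t : ℝ => (t : ℂ)) Complex.ofReal_zero)
  rw [integral_complex_ofReal] at h
  have h2 : ∫ γ, (f (η.translate γ) : ℂ) ∂H.measure η.src = ∫ γ, (f γ : ℝ) ∂H.measure η.tgt := by
    rw [← h]
    refine integral_congr_ae ?_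
    filter_upwards [H.ae_tgt η.src] with γ hγ
    simp only [dif_pos hγ.symm, Arr.translate_of_eq hγ.symm]
  rw [integral_complex_ofReal] at h2
  exact_mod_cast h2

end Haar

/-! ### Orbit integrals -/

section OrbitIntegral

variable [TopologicalSpace X] [TopologicalSpace (Arr X)] {A : X → Type w}
  [∀ x, NonUnitalCStarAlgebra (A x)] [TopologicalSpace (TotalSpace Unit A)]

theorem DynamicalSystem.norm_act (α : DynamicalSystem A) {x y : X} (g : x ⟶ y) (a : A x) :
    ‖α.act g a‖ = ‖a‖ :=
  NonUnitalStarAlgHom.norm_map (α.act g) (α.act g).injective a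

/-- `α_γ(h(s(γ)))` as a point of the total space. -/
def DynamicalSystem.actTotal (α : DynamicalSystem A) (h : ∀ x, A x) (γ : Arr X) :
    TotalSpace Unit A := ⟨γ.tgt, α.act γ.hom (h γ.src)⟩

theorem orbitFunction_tgt (α : DynamicalSystem A) (h : ∀ x, A x) (γ : Arr X) :
    orbitFunction α h γ.tgt γ = α.act γ.hom (h γ.src) := by
  simp [orbitFunction]

theorem orbitFunction_of_ne (α : DynamicalSystem A) (h : ∀ x, A x) {u : X} {γ : Arr X}
    (hγ : γ.tgt ≠ u) : orbitFunction α h u γ = 0 := dif_neg hγ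

theorem mk_orbitFunction (α : DynamicalSystem A) (h : ∀ x, A x) {u : X} {γ : Arr X}
    (hγ : γ.tgt = u) :
    (⟨u, orbitFunction α h u γ⟩ : TotalSpace Unit A) = α.actTotal h γ := by
  subst hγ
  rw [orbitFunction_tgt]
  rfl

theorem orbitFunction_eq_zero (α : DynamicalSystem A) {h : ∀ x, A x} {u : X} {γ : Arr X}
    (hγ : h γ.src = 0) : orbitFunction α h u γ = 0 := by
  by_cases hu : γ.tgt = u
  · subst hu
    rw [orbitFunction_tgt, hγ, map_zero]
  · exact orbitFunction_of_ne α h hu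

theorem continuous_actTotal (α : DynamicalSystem A) {h : ∀ x, A x} (hh : IsContinuousSection h)
    (hsrc : Continuous (Arr.src : Arr X → X)) : Continuous (α.actTotal h) := by
  have h1 : Continuous fun γ : Arr X =>
      (⟨γ, h γ.src⟩ : TotalSpace Unit ((Arr.src : Arr X → X) *ᵖ A)) := by
    rw [(inducing_pullbackTotalSpaceEmbedding (F := Unit) (E := A)
      (Arr.src : Arr X → X)).continuous_iff]
    exact continuous_id.prodMk (hh.comp hsrc)
  exact α.continuous_act.comp h1

variable [TopologicalGroupoid X] [SecondCountableTopology (Arr X)] [LocallyCompactSpace (Arr X)]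
  [T2Space (Arr X)] [MeasurableSpace (Arr X)] [BorelSpace (Arr X)] [UscCStarBundle A]

/-- Convergence in the total space within one fibre implies norm convergence (`tendsto_fibre`). -/
theorem continuousOn_orbitFunction (α : DynamicalSystem A) {h : ∀ x, A x}
    (hh : IsContinuousSection h) (u : X) :
    ContinuousOn (orbitFunction α h u) {γ | γ.tgt = u} := by
  intro γ hγ
  refine tendsto_fibre ?_
  rw [mk_orbitFunction α h hγ]
  refine ((continuous_actTotal α hh continuous_src).continuousWithinAt (s := {γ | γ.tgt = u})
    (x := γ)).tendsto.congr' ?_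
  filter_upwards [self_mem_nhdsWithin] with γ' hγ'
  exact (mk_orbitFunction α h hγ').symm

theorem integrable_smul_orbitFunction (H : HaarSystem X) (hproper : IsProperGroupoid X)
    (α : DynamicalSystem A) {h : ∀ x, A x} (hh : IsCompactlySupportedSection h) {φ : Arr X → ℝ}
    (hφ : Continuous φ) (u : X) :
    Integrable (fun γ => (φ γ : ℂ) • orbitFunction α h u γ) (H.measure u) := by
  have hC := isCompact_src_tgt hproper hh.2 u
  have h1 : ContinuousOn (fun γ => (φ γ : ℂ) • orbitFunction α h u γ)
      {γ : Arr X | γ.src ∈ closure {x | h x ≠ 0} ∧ γ.tgt = u} :=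
    (Complex.continuous_ofReal.comp hφ).continuousOn.smul
      ((continuousOn_orbitFunction α hh.1 u).mono fun γ hγ => hγ.2)
  refine (integrableOn_iff_integrable_of_support_subset ?_).1 (h1.integrableOn_compact hC)
  intro γ hγ
  refine ⟨subset_closure fun h0 => hγ ?_, by_contra fun h0 => hγ ?_⟩
  · simp only [orbitFunction_eq_zero α h0, smul_zero]
  · simp only [orbitFunction_of_ne α h h0, smul_zero]

theorem integrable_orbitFunction (H : HaarSystem X) (hproper : IsProperGroupoid X)
    (α : DynamicalSystem A) {h : ∀ x, A x} (hh : IsCompactlySupportedSection h) (u : X) :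
    Integrable (orbitFunction α h u) (H.measure u) := by
  simpa using integrable_smul_orbitFunction H hproper α hh (φ := fun _ => 1) continuous_const u

theorem norm_integral_smul_sub_le (H : HaarSystem X) (hproper : IsProperGroupoid X)
    (α : DynamicalSystem A) {h : ∀ x, A x} (hh : IsCompactlySupportedSection h) {φ : Arr X → ℝ}
    (hφ : Continuous φ) (hφ0 : ∀ γ, 0 ≤ φ γ) (hφc : HasCompactSupport φ) {u : X} {d : A u}
    {ε : ℝ} (hd : ∀ γ, γ.tgt = u → φ γ ≠ 0 → ‖orbitFunction α h u γ - d‖ ≤ ε) :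
    ‖∫ γ, (φ γ : ℂ) • orbitFunction α h u γ ∂H.measure u -
      ((∫ γ, φ γ ∂H.measure u : ℝ) : ℂ) • d‖ ≤ ε * ∫ γ, φ γ ∂H.measure u := by
  have hi : Integrable φ (H.measure u) := hφ.integrable_of_hasCompactSupport hφc
  have hi' : Integrable (fun γ => (φ γ : ℂ)) (H.measure u) := hi.ofReal
  rw [← integral_complex_ofReal, ← integral_smul_const, ← integral_sub
    (integrable_smul_orbitFunction H hproper α hh hφ u) (hi'.smul_const d),
    ← integral_const_mul]
  refine norm_integral_le_of_norm_le (hi.const_mul ε) ?_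
  filter_upwards [H.ae_tgt u] with γ hγ
  rw [← smul_sub, norm_smul, Complex.norm_real, Real.norm_of_nonneg (hφ0 γ), mul_comm]
  by_cases h0 : φ γ = 0
  · simp [h0]
  · exact mul_le_mul_of_nonneg_right (hd γ hγ h0) (hφ0 γ)

/-- On the support of φ the integrand stays in U, whose fibrewise diameter is at most ε, so the
integral is within ε ∫ φ of (∫ φ) • d for every d of U in that fibre. -/
theorem oscLT_integral_smul (H : HaarSystem X) (hproper : IsProperGroupoid X)
    (α : DynamicalSystem A) {h : ∀ x, A x} (hh : IsCompactlySupportedSection h) {φ : Arr X → ℝ}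
    (hφ : Continuous φ) (hφ0 : ∀ γ, 0 ≤ φ γ) (hφc : HasCompactSupport φ)
    {U : Set (TotalSpace Unit A)} (hU : IsOpen U) {ε : ℝ} (hUsub : ∀ (x : X) (a c : A x),
      (⟨x, a⟩ : TotalSpace Unit A) ∈ U → (⟨x, c⟩ : TotalSpace Unit A) ∈ U → ‖a - c‖ < ε)
    (hφU : ∀ γ, φ γ ≠ 0 → α.actTotal h γ ∈ U) {γ₀ : Arr X} (hγ₀ : α.actTotal h γ₀ ∈ U)
    {δ : ℝ} (hδ : 0 < δ) :
    OscLT (fun y => ∫ γ, (φ γ : ℂ) • orbitFunction α h y γ ∂H.measure y) γ₀.tgt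
      (2 * ε * (∫ γ, φ γ ∂H.measure γ₀.tgt) + δ) := by
  refine oscLT_of_norm_sub_smul_le (w := fun y => ∫ γ, φ γ ∂H.measure y)
    (H.continuous_integral_real hφ hφc).continuousAt hU (c := α.act γ₀.hom (h γ₀.src)) hγ₀
    (fun y d hd => ?_) hδ
  refine norm_integral_smul_sub_le H hproper α hh hφ hφ0 hφc fun γ hγ hγ0 => ?_
  refine (hUsub y _ _ ?_ hd).le
  rw [mk_orbitFunction α h hγ]
  exact hφU γ hγ0

/-- Here S is the total mass of the pieces. The mass term costs ε/2, the n individual slacks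
together ε/4, and the slack of the sum ε/4. -/
theorem oscillation_budget {ε M S : ℝ} (hε : 0 < ε) (hM : 0 ≤ M) (hS : S ≤ M) (n : ℕ) :
    2 * (ε / (4 * (M + 1))) * S + n * (ε / (4 * (n + 1))) + ε / 4 ≤ ε := by
  have h1 : 2 * (ε / (4 * (M + 1))) * S ≤ ε / 2 * (M / (M + 1)) := by
    calc 2 * (ε / (4 * (M + 1))) * S ≤ 2 * (ε / (4 * (M + 1))) * M := by gcongr
      _ = ε / 2 * (M / (M + 1)) := by field_simp; ring
  have h2 : ε / 2 * (M / (M + 1)) ≤ ε / 2 :=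
    mul_le_of_le_one_right (by positivity) ((div_le_one (by positivity)).2 (by linarith))
  have h3 : (n : ℝ) * (ε / (4 * (n + 1))) = ε / 4 * (n / (n + 1)) := by field_simp
  have h4 : ε / 4 * (n / (n + 1) : ℝ) ≤ ε / 4 :=
    mul_le_of_le_one_right (by positivity) ((div_le_one (by positivity)).2 (by linarith))
  linarith

theorem isContinuousSection_orbitIntegral (H : HaarSystem X) (hproper : IsProperGroupoid X)
    (α : DynamicalSystem A) {h : ∀ x, A x} (hh : IsCompactlySupportedSection h) :
    IsContinuousSection (orbitIntegral H α h) := by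
  have := locallyCompactSpace_units (X := X)
  have := t2Space_units (X := X)
  refine continuous_iff_continuousAt.2 fun u => continuousAt_of_oscLT fun ε hε => ?_
  have hδ : ∀ n : ℕ, 0 < ε / (4 * ((n : ℝ) + 1)) := fun n => by positivity
  set K := closure {x | h x ≠ 0} with hK
  obtain ⟨N, hN, hNu⟩ := exists_compact_mem_nhds u
  have hK' := hproper K N hh.2 hN
  obtain ⟨ψ, hψ1, -, hψc, hψ⟩ := exists_continuous_one_zero_of_isCompact hK' isClosed_empty
    (Set.disjoint_empty _)
  -- M bounds the total mass of the pieces however many there are, so ε' can be fixed before the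
  -- cover is chosen.
  set M := ∫ γ, ψ γ ∂H.measure u with hM
  have hM0 : 0 ≤ M := integral_nonneg fun γ => (hψ γ).1
  set ε' := ε / (4 * (M + 1)) with hε'
  have hε'0 : 0 < ε' := by positivity
  choose U hU hUmem hUsub using fun γ => exists_nhds_norm_sub_lt (α.actTotal h γ) hε'0
  set O : Arr X → Set (Arr X) := fun γ => α.actTotal h ⁻¹' U γ with hO
  have hOo : ∀ γ, IsOpen (O γ) := fun γ =>
    (hU γ).preimage (continuous_actTotal α hh.1 continuous_src)
  have hC0 := isCompact_src_tgt hproper hh.2 u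
  obtain ⟨t, htC, ht⟩ := hC0.elim_nhds_subcover O fun γ _ => (hOo γ).mem_nhds (hUmem γ)
  -- Tube argument: the uncovered arrows over N form a compact set whose range misses u, so over a
  -- smaller neighbourhood N' everything with source in K is covered.
  have hD : IsCompact ({γ : Arr X | γ.src ∈ K ∧ γ.tgt ∈ N} \ ⋃ γ ∈ t, O γ) :=
    hK'.diff (isOpen_biUnion fun γ _ => hOo γ)
  have hDu : u ∉ Arr.tgt '' ({γ : Arr X | γ.src ∈ K ∧ γ.tgt ∈ N} \ ⋃ γ ∈ t, O γ) := by
    rintro ⟨γ, ⟨hγ, hγO⟩, hγu⟩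
    exact hγO (ht ⟨hγ.1, hγu⟩)
  obtain ⟨N', hN'u, hN'sub, hN'⟩ := local_compact_nhds (inter_mem hNu
    ((hD.image continuous_tgt).isClosed.isOpen_compl.mem_nhds hDu))
  have hK'' := hproper K N' hh.2 hN'
  have hcov : {γ : Arr X | γ.src ∈ K ∧ γ.tgt ∈ N'} ⊆ ⋃ i : t, O i := by
    intro γ hγ
    by_contra hγO
    have h1 := hN'sub hγ.2
    refine h1.2 ⟨γ, ⟨⟨hγ.1, h1.1⟩, fun h2 => hγO ?_⟩, rfl⟩
    simpa using h2
  obtain ⟨f, hf⟩ := PartitionOfUnity.exists_isSubordinate hK''.isClosed (fun i : t => O i)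
    (fun i => hOo i) hcov
  -- The factor ψ supplies compact support and equals 1 on the arrows from K to N, where the
  -- decomposition is needed.
  set φ : t → Arr X → ℝ := fun i γ => f i γ * ψ γ with hφdef
  have hφ : ∀ i, Continuous (φ i) := fun i => (f i).continuous.mul ψ.continuous
  have hφ0 : ∀ i γ, 0 ≤ φ i γ := fun i γ => mul_nonneg (f.nonneg i γ) (hψ γ).1
  have hφc : ∀ i, HasCompactSupport (φ i) := fun i => hψc.mul_left
  have hsum : ∑ i, ∫ γ, φ i γ ∂H.measure u ≤ M := by
    rw [← integral_finsetSum _ fun i _ => (hφ i).integrable_of_hasCompactSupport (hφc i)]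
    refine integral_mono (integrable_finsetSum _ fun i _ =>
      (hφ i).integrable_of_hasCompactSupport (hφc i))
      (ψ.continuous.integrable_of_hasCompactSupport hψc) fun γ => ?_
    simp only [hφdef, ← Finset.sum_mul]
    have := f.sum_le_one γ
    rw [finsum_eq_sum_of_fintype] at this
    exact mul_le_of_le_one_left (hψ γ).1 this
  have hosc : ∀ i : t, OscLT (fun y => ∫ γ, (φ i γ : ℂ) • orbitFunction α h y γ ∂H.measure y) u
      (2 * ε' * (∫ γ, φ i γ ∂H.measure u) + ε / (4 * (t.card + 1))) := fun i => by
    have h1 := oscLT_integral_smul H hproper α hh (hφ i) (hφ0 i) (hφc i) (hU i) (hUsub i)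
      (fun γ hγ => hf i (subset_tsupport _ (left_ne_zero_of_mul hγ))) (hUmem i)
      (hδ t.card)
    rwa [show (i : Arr X).tgt = u from (htC i i.2).2] at h1
  have htot := OscLT.sum Finset.univ (fun i _ => hosc i) (show 0 < ε / 4 by positivity)
  refine (htot.congr ?_).mono ?_
  · filter_upwards [hN'u] with y hy
    rw [← integral_finsetSum _ fun i _ => integrable_smul_orbitFunction H hproper α hh (hφ i) y]
    refine integral_congr_ae ?_
    filter_upwards [H.ae_tgt y] with γ hγ
    by_cases h0 : h γ.src = 0
    · simp [orbitFunction_eq_zero α h0]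
    · have hγK : γ.src ∈ K := subset_closure h0
      have h1 := f.sum_eq_one (x := γ) ⟨hγK, hγ ▸ hy⟩
      rw [finsum_eq_sum_of_fintype] at h1
      have h2 : ψ γ = 1 := hψ1 ⟨hγK, (hN'sub (hγ ▸ hy)).1⟩
      rw [← Finset.sum_smul]
      simp only [hφdef, h2, mul_one]
      rw [← Complex.ofReal_sum, h1]
      simp
  · refine fun z hz => hz.trans_le ?_
    rw [Finset.sum_add_distrib, ← Finset.mul_sum]
    simp only [Finset.sum_const, Finset.card_univ, Fintype.card_coe, nsmul_eq_mul]
    exact oscillation_budget hε hM0 hsum t.card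

theorem orbitFunction_translate (α : DynamicalSystem A) (h : ∀ x, A x) {η γ : Arr X}
    (hγ : γ.tgt = η.src) :
    orbitFunction α h η.tgt (η.translate γ) = α.act η.hom (orbitFunction α h η.src γ) := by
  obtain ⟨x, y, e⟩ := η
  obtain ⟨z, x', g⟩ := γ
  obtain rfl : x' = x := hγ
  rw [Arr.translate_of_eq rfl]
  refine (orbitFunction_tgt α h (Arr.mul ⟨x', y, e⟩ ⟨z, x', g⟩ rfl)).trans ?_
  rw [show orbitFunction α h x' ⟨z, x', g⟩ = α.act g (h z) from
    orbitFunction_tgt α h ⟨z, x', g⟩, ← α.act_mul]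
  simp only [Arr.mul, eqToHom_refl, Category.id_comp]
  rfl

/-- Left translation by η carries λ^{s(η)} to λ^{r(η)}, and α_η, being a linear isometry, commutes
with the integral. -/
theorem orbitIntegral_tgt (H : HaarSystem X) (hproper : IsProperGroupoid X)
    (α : DynamicalSystem A) {h : ∀ x, A x} (hh : IsCompactlySupportedSection h) (η : Arr X) :
    orbitIntegral H α h η.tgt = α.act η.hom (orbitIntegral H α h η.src) := by
  let L : A η.src →ₗᵢ[ℂ] A η.tgt :=
    { toFun := α.act η.hom
      map_add' := map_add _
      map_smul' := map_smul _
      norm_map' := α.norm_act η.hom }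
  have h1 := integrable_orbitFunction H hproper α hh η.tgt
  unfold orbitIntegral
  rw [← H.map_translate hproper η] at h1 ⊢
  rw [integral_map (H.aemeasurable_translate η) h1.aestronglyMeasurable]
  refine Eq.trans ?_ (L.toContinuousLinearMap.integral_comp_comm
    (integrable_orbitFunction H hproper α hh η.src))
  refine integral_congr_ae ?_
  filter_upwards [H.ae_tgt η.src] with γ hγ
  exact orbitFunction_translate α h hγ

end OrbitIntegral

/-! ### Section algebras -/

section SectionAlgebras

variable {B : Type u} {A : B → Type w} [∀ x, NonUnitalCStarAlgebra (A x)]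

theorem VanishesAtInfinityAlong.of_approx {Y : Type*} [TopologicalSpace Y] {q : B → Y}
    {f : ∀ x, A x} (h : ∀ ε : ℝ, 0 < ε → ∃ g : ∀ x, A x, VanishesAtInfinityAlong q g ∧
      ∀ x, ‖f x - g x‖ < ε) : VanishesAtInfinityAlong q f := by
  intro ε hε
  obtain ⟨g, hg, hfg⟩ := h (ε / 2) (half_pos hε)
  obtain ⟨K, hK, hgK⟩ := hg (ε / 2) (half_pos hε)
  refine ⟨K, hK, fun x hx => ?_⟩
  have := norm_add_le (f x - g x) (g x)
  rw [sub_add_cancel] at this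
  linarith [hfg x, hgK x hx]

theorem exists_norm_sub_apply_lt {S : Set (lp A ∞)} {f : lp A ∞} (hf : f ∈ closure S) {ε : ℝ}
    (hε : 0 < ε) : ∃ g ∈ S, ∀ x, ‖f x - g x‖ < ε := by
  obtain ⟨g, hg, hfg⟩ := Metric.mem_closure_iff.1 hf ε hε
  refine ⟨g, hg, fun x => lt_of_le_of_lt ?_ (dist_eq_norm f g ▸ hfg)⟩
  exact lp.norm_apply_le_norm (by simp) (f - g) x

variable [TopologicalSpace B] [TopologicalSpace (TotalSpace Unit A)] [UscCStarBundle A]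

variable (A) in
theorem isClosed_boundedSections : IsClosed (boundedSections A : Set (lp A ∞)) := by
  refine isClosed_of_closure_subset fun f hf => isContinuousSection_of_approx fun ε hε => ?_
  obtain ⟨g, hg, h⟩ := exists_norm_sub_apply_lt hf hε
  exact ⟨g, hg, h⟩

theorem IsCompactlySupportedSection.of_ne_zero {f g : ∀ x, A x}
    (hf : IsCompactlySupportedSection f) (hg : IsContinuousSection g)
    (h : ∀ x, g x ≠ 0 → f x ≠ 0) : IsCompactlySupportedSection g :=
  ⟨hg, hf.2.of_isClosed_subset isClosed_closure (closure_mono h)⟩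

theorem IsContinuousSection.smul_compactlySupported {f : ∀ x, A x} (hf : IsContinuousSection f)
    {κ : B → ℂ} (hκ : Continuous κ) (hc : HasCompactSupport κ) :
    IsCompactlySupportedSection (fun x => κ x • f x) :=
  ⟨hf.smul_fun hκ, hc.of_isClosed_subset isClosed_closure
    (closure_mono fun _ hx => left_ne_zero_of_smul hx)⟩

theorem IsCompactlySupportedSection.vanishesAtInfinity {f : ∀ x, A x}
    (hf : IsCompactlySupportedSection f) : VanishesAtInfinityAlong (id : B → B) f :=
  fun ε hε => ⟨_, hf.2, fun x hx => by
    have : f x = 0 := by_contra fun h => hx (subset_closure h)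
    simpa [this] using hε⟩

/-- An upper semicontinuous norm is still locally bounded above. -/
theorem IsContinuousSection.exists_norm_le {f : ∀ x, A x} (hf : IsContinuousSection f) {K : Set B}
    (hK : IsCompact K) : ∃ C, ∀ x ∈ K, ‖f x‖ ≤ C := by
  obtain ⟨t, -, ht⟩ := hK.elim_nhds_subcover (fun x => {y | ‖f y‖ < ‖f x‖ + 1}) fun x _ =>
    eventually_norm_lt (hf.tendsto x) (lt_add_one ‖f x‖)
  refine ⟨∑ x ∈ t, (‖f x‖ + 1), fun y hy => ?_⟩
  obtain ⟨x, hx, hxy⟩ := Set.mem_iUnion₂.1 (ht hy)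
  exact (le_of_lt hxy).trans (Finset.single_le_sum (f := fun x => ‖f x‖ + 1)
    (fun i _ => by positivity) hx)

instance : CStarRing (sectionAlgebra A) :=
  ⟨fun c => CStarRing.norm_mul_self_le (c : lp A ∞)⟩

/-- The multiplier is tested on φ f⋆, with a cut-off φ equal to 1 at x; this lies in Γ_0, has norm
at most ‖f‖, and f(x)f(x)⋆ has norm ‖f(x)‖². -/
theorem norm_apply_sq_le [T2Space B] [LocallyCompactSpace B] (f : boundedSections A) (x : B) :
    ‖(f : lp A ∞) x‖ * ‖(f : lp A ∞) x‖ ≤ ‖(toMultiplier f).fst‖ * ‖f‖ := by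
  obtain ⟨φ, hφ1, -, hφc, hφ⟩ := exists_continuous_one_zero_of_isCompact
    (isCompact_singleton (x := x)) isClosed_empty (Set.disjoint_empty _)
  have hc := (IsContinuousSection.star f.2).smul_compactlySupported
    (Complex.continuous_ofReal.comp φ.continuous)
    (hφc.comp_left (g := fun t : ℝ => (t : ℂ)) Complex.ofReal_zero)
  have hle : ∀ y, ‖(φ y : ℂ) • star ((f : lp A ∞) y)‖ ≤ ‖f‖ := fun y => by
    have h1 := norm_smul (φ y : ℂ) (star ((f : lp A ∞) y))
    rw [norm_star, Complex.norm_real, Real.norm_of_nonneg (hφ y).1] at h1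
    exact h1.le.trans ((mul_le_of_le_one_left (norm_nonneg _) (hφ y).2).trans
      (lp.norm_apply_le_norm (by simp) (f : lp A ∞) y))
  have hmem : Memℓp (fun y => (φ y : ℂ) • star ((f : lp A ∞) y)) ∞ :=
    memℓp_infty ⟨‖f‖, by rintro - ⟨y, rfl⟩; exact hle y⟩
  let c : sectionAlgebra A := ⟨⟨_, hmem⟩, hc.1, hc.vanishesAtInfinity⟩
  have hcn : ‖c‖ ≤ ‖f‖ := lp.norm_le_of_forall_le (f := (c : lp A ∞)) (norm_nonneg _) hle
  have h1 : (((toMultiplier f).fst c : sectionAlgebra A) : lp A ∞) x =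
      (f : lp A ∞) x * ((φ x : ℂ) • star ((f : lp A ∞) x)) := rfl
  rw [hφ1 rfl, Pi.one_apply, Complex.ofReal_one, one_smul] at h1
  rw [← CStarRing.norm_self_mul_star, ← h1]
  calc _ ≤ ‖(toMultiplier f).fst c‖ :=
        lp.norm_apply_le_norm (by simp) (((toMultiplier f).fst c : sectionAlgebra A) : lp A ∞) x
    _ ≤ ‖(toMultiplier f).fst‖ * ‖c‖ := ContinuousLinearMap.le_opNorm _ _
    _ ≤ _ := by gcongr

theorem isometry_toMultiplier [T2Space B] [LocallyCompactSpace B] :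
    Isometry (toMultiplier : boundedSections A →⋆ₙₐ[ℂ] 𝓜(ℂ, sectionAlgebra A)) := by
  refine AddMonoidHomClass.isometry_of_norm _ fun f => ?_
  rw [← DoubleCentralizer.norm_fst]
  refine le_antisymm (ContinuousLinearMap.opNorm_le_bound _ (norm_nonneg _) fun c =>
    norm_mul_le (f : lp A ∞) (c : lp A ∞)) ?_
  have h0 : 0 ≤ ‖(toMultiplier f).fst‖ * ‖f‖ := by positivity
  have h1 : ‖f‖ ≤ √(‖(toMultiplier f).fst‖ * ‖f‖) :=
    lp.norm_le_of_forall_le (f := (f : lp A ∞)) (Real.sqrt_nonneg _) fun x =>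
      Real.le_sqrt_of_sq_le (by rw [sq]; exact norm_apply_sq_le f x)
  rw [Real.le_sqrt (norm_nonneg _) h0, sq] at h1
  rcases (norm_nonneg f).eq_or_lt with h2 | h2
  · rw [← h2]
    exact norm_nonneg _
  · exact le_of_mul_le_mul_right h1 h2

end SectionAlgebras

/-- A C⋆-algebra is the linear span of its positive elements, each of the form b⋆b. -/
theorem mem_of_star_mul_self_mem {C : Type*} [NonUnitalCStarAlgebra C] {V : Submodule ℂ C}
    (hV : ∀ b : C, star b * b ∈ V) (x : C) : x ∈ V := by
  let _ := CStarAlgebra.spectralOrder C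
  have := CStarAlgebra.spectralOrderedRing C
  have h : Submodule.span ℂ {a : C | 0 ≤ a} ≤ V := by
    refine Submodule.span_le.2 fun a ha => ?_
    obtain ⟨b, rfl⟩ := CStarAlgebra.nonneg_iff_eq_star_mul_self.1 (show 0 ≤ a from ha)
    exact hV b
  rw [CStarAlgebra.span_nonneg] at h
  exact h trivial

/-! ### The induced algebra: closedness, and membership of the orbit integrals -/

section Induced

variable [TopologicalSpace X] [TopologicalSpace (Arr X)] {A : X → Type w}
  [∀ x, NonUnitalCStarAlgebra (A x)] [TopologicalSpace (TotalSpace Unit A)] [UscCStarBundle A]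

theorem isClosed_inducedAlgebra (α : DynamicalSystem A) :
    IsClosed (inducedAlgebra α : Set (boundedSections A)) := by
  have happ : ∀ f ∈ closure (inducedAlgebra α : Set (boundedSections A)), ∀ ε : ℝ, 0 < ε →
      ∃ g ∈ inducedAlgebra α, ∀ x, ‖(f : lp A ∞) x - (g : lp A ∞) x‖ < ε := fun f hf ε hε => by
    obtain ⟨g, hg, hfg⟩ := Metric.mem_closure_iff.1 hf ε hε
    rw [dist_eq_norm] at hfg
    exact ⟨g, hg, fun x => lt_of_le_of_lt
      (lp.norm_apply_le_norm (by simp) ((f : lp A ∞) - (g : lp A ∞)) x) hfg⟩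
  refine isClosed_of_closure_subset fun f hf => ⟨fun γ => ?_,
    VanishesAtInfinityAlong.of_approx fun ε hε => ?_⟩
  · rw [← sub_eq_zero, ← norm_le_zero_iff]
    refine le_of_forall_pos_le_add fun ε hε => ?_
    obtain ⟨g, hg, hfg⟩ := happ f hf (ε / 2) (half_pos hε)
    have h1 : (f : lp A ∞) γ.tgt - α.act γ.hom ((f : lp A ∞) γ.src) =
        ((f : lp A ∞) γ.tgt - (g : lp A ∞) γ.tgt) -
          α.act γ.hom ((f : lp A ∞) γ.src - (g : lp A ∞) γ.src) := by
      rw [map_sub, ← hg.1 γ]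
      abel
    rw [h1]
    refine (norm_sub_le _ _).trans ?_
    rw [α.norm_act]
    linarith [hfg γ.tgt, hfg γ.src]
  · obtain ⟨g, hg, h⟩ := happ f hf ε hε
    exact ⟨(g : lp A ∞), hg.2, h⟩

variable [TopologicalGroupoid X] [SecondCountableTopology (Arr X)] [LocallyCompactSpace (Arr X)]
  [T2Space (Arr X)] [MeasurableSpace (Arr X)] [BorelSpace (Arr X)]

theorem exists_mem_inducedAlgebra (H : HaarSystem X) (hproper : IsProperGroupoid X)
    (α : DynamicalSystem A) {h : ∀ x, A x} (hh : IsCompactlySupportedSection h) :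
    ∃ f ∈ inducedAlgebra α, ∀ u, (f : lp A ∞) u = orbitIntegral H α h u := by
  have hcont := isContinuousSection_orbitIntegral H hproper α hh
  obtain ⟨C, hC⟩ := hcont.exists_norm_le hh.2
  have hzero : ∀ u, orbit u ∉ orbit '' closure {x | h x ≠ 0} → orbitIntegral H α h u = 0 := by
    intro u hu
    refine integral_eq_zero_of_ae ?_
    filter_upwards [H.ae_tgt u] with γ hγ
    refine orbitFunction_eq_zero α (by_contra fun h0 => hu ⟨γ.src, subset_closure h0, ?_⟩)
    rw [← hγ, orbit_tgt_eq]
  -- The norm of λ(h) is constant on orbits, and an orbit where it is nonzero meets the compact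
  -- support of h; a bound there is global.
  have hbdd : Memℓp (orbitIntegral H α h) ∞ := by
    refine memℓp_infty ⟨max C 0, ?_⟩
    rintro - ⟨u, rfl⟩
    by_cases hu : orbit u ∈ orbit '' closure {x | h x ≠ 0}
    · obtain ⟨x, hx, hxu⟩ := hu
      obtain ⟨η, rfl, rfl⟩ := exists_arr_of_orbit_eq hxu
      simp only [orbitIntegral_tgt H hproper α hh, α.norm_act]
      exact (hC _ hx).trans (le_max_left _ _)
    · simp [hzero u hu]
  exact ⟨⟨⟨_, hbdd⟩, hcont⟩, ⟨fun γ => orbitIntegral_tgt H hproper α hh γ, fun ε hε =>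
    ⟨_, hh.2.image continuous_orbit, fun u hu => by
      change ‖orbitIntegral H α h u‖ < ε
      rwa [hzero u hu, norm_zero]⟩⟩, fun u => rfl⟩

end Induced

/-! ### Cut-off functions -/

section Cutoff

variable [TopologicalSpace X] [TopologicalSpace (Arr X)] [TopologicalGroupoid X]
  [SecondCountableTopology (Arr X)] [LocallyCompactSpace (Arr X)]
  [T2Space (Arr X)] [MeasurableSpace (Arr X)] [BorelSpace (Arr X)]

/-- The function w ∘ s need not have compact support. Over a compact neighbourhood of u it agrees
with χ(r(γ)) w(s(γ)), which does by properness, so the Haar continuity axiom applies locally. -/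
theorem exists_local_extension (hproper : IsProperGroupoid X) {w : X → ℝ} (hw : Continuous w)
    (hwc : HasCompactSupport w) (u : X) : ∃ Φ : Arr X → ℝ, Continuous Φ ∧ HasCompactSupport Φ ∧
      ∀ᶠ y in 𝓝 u, ∀ γ : Arr X, γ.tgt = y → Φ γ = w γ.src := by
  have := locallyCompactSpace_units (X := X)
  have := t2Space_units (X := X)
  obtain ⟨N, hN, hNu⟩ := exists_compact_mem_nhds u
  obtain ⟨χ, hχ1, -, hχc, -⟩ := exists_continuous_one_zero_of_isCompact hN isClosed_empty
    (Set.disjoint_empty _)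
  refine ⟨fun γ => χ γ.tgt * w γ.src, (χ.continuous.comp continuous_tgt).mul
    (hw.comp continuous_src), HasCompactSupport.intro (hproper _ _ hwc hχc) fun γ hγ => ?_, ?_⟩
  · by_contra h0
    exact hγ ⟨subset_tsupport _ (right_ne_zero_of_mul h0),
      subset_tsupport _ (left_ne_zero_of_mul h0)⟩
  · filter_upwards [hNu] with y hy γ hγ
    rw [hγ, hχ1 hy, Pi.one_apply, one_mul]

theorem HaarSystem.integrable_comp_src (H : HaarSystem X) (hproper : IsProperGroupoid X)
    {w : X → ℝ} (hw : Continuous w) (hwc : HasCompactSupport w) (u : X) :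
    Integrable (fun γ => w γ.src) (H.measure u) := by
  obtain ⟨Φ, hΦ, hΦc, h⟩ := exists_local_extension hproper hw hwc u
  refine (hΦ.integrable_of_hasCompactSupport hΦc).congr ?_
  filter_upwards [H.ae_tgt u] with γ hγ
  exact h.self_of_nhds γ hγ

theorem HaarSystem.continuous_integral_comp_src (H : HaarSystem X) (hproper : IsProperGroupoid X)
    {w : X → ℝ} (hw : Continuous w) (hwc : HasCompactSupport w) :
    Continuous fun u => ∫ γ, w γ.src ∂H.measure u := by
  refine continuous_iff_continuousAt.2 fun u => ?_
  obtain ⟨Φ, hΦ, hΦc, h⟩ := exists_local_extension hproper hw hwc u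
  refine (H.continuous_integral_real hΦ hΦc).continuousAt.congr ?_
  filter_upwards [h] with y hy
  refine integral_congr_ae ?_
  filter_upwards [H.ae_tgt y] with γ hγ
  exact hy γ hγ

theorem HaarSystem.integral_comp_src_tgt (H : HaarSystem X) (hproper : IsProperGroupoid X)
    {w : X → ℝ} (hw : Continuous w) (η : Arr X) :
    ∫ γ, w γ.src ∂H.measure η.tgt = ∫ γ, w γ.src ∂H.measure η.src := by
  rw [← H.map_translate hproper η]
  refine (integral_map (H.aemeasurable_translate η)
    (hw.comp continuous_src).aestronglyMeasurable).trans ?_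
  refine integral_congr_ae ?_
  filter_upwards [H.ae_tgt η.src] with γ hγ
  rw [Function.comp_apply, Arr.translate_of_eq hγ.symm]
  rfl

theorem HaarSystem.integral_comp_src_eq (H : HaarSystem X) (hproper : IsProperGroupoid X)
    {w : X → ℝ} (hw : Continuous w) {x y : X} (h : orbit x = orbit y) :
    ∫ γ, w γ.src ∂H.measure y = ∫ γ, w γ.src ∂H.measure x := by
  obtain ⟨η, rfl, rfl⟩ := exists_arr_of_orbit_eq h
  exact H.integral_comp_src_tgt hproper hw η

end Cutoff

/-! ### The induced algebra as generalized fixed point algebra -/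

section Approximation

variable [TopologicalSpace X] [TopologicalSpace (Arr X)] {A : X → Type w}
  [∀ x, NonUnitalCStarAlgebra (A x)] [TopologicalSpace (TotalSpace Unit A)] [UscCStarBundle A]
  [TopologicalGroupoid X] [SecondCountableTopology (Arr X)] [LocallyCompactSpace (Arr X)]
  [T2Space (Arr X)] [MeasurableSpace (Arr X)] [BorelSpace (Arr X)]

/-- If `f` is equivariant and `κ = w / v` with `v` constant on orbits, then
`λ(κ f)(u) = (∫ w(s(γ)) dλ^u(γ) / v(u)) f(u)`. -/
theorem orbitIntegral_div_smul (H : HaarSystem X) (α : DynamicalSystem A) {f : ∀ x, A x}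
    (hf : ∀ γ : Arr X, f γ.tgt = α.act γ.hom (f γ.src)) (w : X → ℝ) {v : X → ℝ}
    (hv : ∀ γ : Arr X, v γ.tgt = v γ.src) (u : X) :
    orbitIntegral H α (fun x => ((w x / v x : ℝ) : ℂ) • f x) u =
      (((∫ γ, w γ.src ∂H.measure u) / v u : ℝ) : ℂ) • f u := by
  rw [← integral_div, ← integral_complex_ofReal, ← integral_smul_const]
  refine integral_congr_ae ?_
  filter_upwards [H.ae_tgt u] with γ hγ
  subst hγ
  rw [orbitFunction_tgt, map_smul, ← hf γ, hv γ]

theorem exists_orbitIntegral_approx (H : HaarSystem X) (hproper : IsProperGroupoid X)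
    (α : DynamicalSystem A) (b : ∀ x, A x) (hb : IsContinuousSection b)
    (hba : ∀ γ : Arr X, b γ.tgt = α.act γ.hom (b γ.src)) {M : ℝ}
    (hM : ∀ x, ‖star (b x) * b x‖ ≤ M)
    (hbv : VanishesAtInfinityAlong (orbit : X → OrbitSpace X) fun x => star (b x) * b x)
    {ε : ℝ} (hε : 0 < ε) :
    ∃ c : ∀ x, A x, IsCompactlySupportedSection c ∧ ∀ u,
      ‖star (b u) * b u - orbitIntegral H α (fun x => star (c x) * c x) u‖ ≤ ε := by
  have := locallyCompactSpace_units (X := X)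
  have := t2Space_units (X := X)
  obtain ⟨K, hK, hfK⟩ := hbv ε hε
  obtain ⟨L, hL, hKL⟩ := exists_isCompact_subset_image_orbit H hK
  obtain ⟨w, hw1, -, hwc, hw⟩ := exists_continuous_one_zero_of_isCompact hL isClosed_empty
    (Set.disjoint_empty _)
  let W : X → ℝ := fun u => ∫ γ, w γ.src ∂H.measure u
  have hW : Continuous W := H.continuous_integral_comp_src hproper w.continuous hwc
  have hW0 : ∀ u, 0 ≤ W u := fun u => integral_nonneg fun γ => (hw _).1
  -- The unit at x lies in the support of λ^x, and w(x) = 1.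
  have hWL : ∀ x ∈ L, 0 < W x := fun x hx =>
    H.integral_pos (w.continuous.comp continuous_src) (fun γ => (hw _).1)
      (H.integrable_comp_src hproper w.continuous hwc x) (γ := Arr.unit x) rfl
      (show 0 < w x by rw [hw1 hx]; exact one_pos)
  obtain ⟨m, hm, hmL⟩ := hL.exists_forall_le' hW.continuousOn hWL
  -- The condition is δ M / m ≤ ε, the error bound on the orbits of L; positivity of δ also keeps W
  -- + δ invertible where W vanishes.
  obtain ⟨δ, hδ, hδm⟩ : ∃ δ : ℝ, 0 < δ ∧ δ * M ≤ ε * m := by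
    refine ⟨ε * m / (|M| + 1), by positivity, ?_⟩
    rw [div_mul_eq_mul_div, div_le_iff₀ (by positivity)]
    exact mul_le_mul_of_nonneg_left ((le_abs_self M).trans (by linarith)) (by positivity)
  have hWδ : ∀ x, 0 < W x + δ := fun x => add_pos_of_nonneg_of_pos (hW0 x) hδ
  -- The square root is taken so that c⋆c carries the weight w / (W + δ).
  let κ : X → ℝ := fun x => √(w x / (W x + δ))
  have hκ : Continuous κ :=
    (w.continuous.div (hW.add continuous_const) fun x => (hWδ x).ne').sqrt
  have hκc : HasCompactSupport κ := hwc.mono fun x hx h0 => hx (by simp [κ, h0])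
  refine ⟨fun x => (κ x : ℂ) • b x, hb.smul_compactlySupported
    (Complex.continuous_ofReal.comp hκ)
    (hκc.comp_left (g := fun t : ℝ => (t : ℂ)) Complex.ofReal_zero), fun u => ?_⟩
  have h1 : (fun x => star ((κ x : ℂ) • b x) * ((κ x : ℂ) • b x)) =
      fun x => ((w x / (W x + δ) : ℝ) : ℂ) • (star (b x) * b x) := by
    funext x
    rw [star_smul, smul_mul_smul_comm, RCLike.star_def, Complex.conj_ofReal, ← Complex.ofReal_mul,
      Real.mul_self_sqrt (div_nonneg (hw x).1 (hWδ x).le)]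
  have h2 := orbitIntegral_div_smul H α (f := fun x => star (b x) * b x)
    (fun γ => by rw [map_mul, map_star, hba γ]) w (v := fun x => W x + δ)
    (fun γ => congrArg (· + δ) (H.integral_comp_src_tgt hproper w.continuous γ)) u
  have h3 : star (b u) * b u - ((W u / (W u + δ) : ℝ) : ℂ) • (star (b u) * b u) =
      ((δ / (W u + δ) : ℝ) : ℂ) • (star (b u) * b u) := by
    have : δ / (W u + δ) = 1 - W u / (W u + δ) := by
      rw [eq_sub_iff_add_eq, ← add_div, add_comm δ, div_self (hWδ u).ne']
    rw [this, Complex.ofReal_sub, Complex.ofReal_one, sub_smul, one_smul]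
  rw [h1, h2]
  change ‖star (b u) * b u - ((W u / (W u + δ) : ℝ) : ℂ) • (star (b u) * b u)‖ ≤ ε
  rw [h3, norm_smul, Complex.norm_real, Real.norm_of_nonneg (div_nonneg hδ.le (hWδ u).le)]
  by_cases hu : orbit u ∈ K
  · obtain ⟨x, hx, hxu⟩ := hKL hu
    have h4 : m ≤ W u + δ := by
      have := H.integral_comp_src_eq hproper w.continuous hxu
      have h5 : W u = W x := this
      linarith [hmL x hx]
    calc δ / (W u + δ) * ‖star (b u) * b u‖ ≤ δ / m * M := by
          gcongr
          exact hM u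
      _ ≤ ε := by rwa [div_mul_eq_mul_div, div_le_iff₀ hm]
  · refine (mul_le_of_le_one_left (norm_nonneg _) ?_).trans (hfK u hu).le
    exact (div_le_one (hWδ u)).2 (by linarith [hW0 u])

theorem isCompactlySupportedSection_star_mul {a b : ∀ x, A x}
    (ha : IsCompactlySupportedSection a) (hb : IsCompactlySupportedSection b) :
    IsCompactlySupportedSection fun x => star (a x) * b x :=
  hb.of_ne_zero (ha.1.star.mul hb.1) fun _ hx => right_ne_zero_of_mul hx

theorem toMultiplier_star_mul_self_mem (H : HaarSystem X) (hproper : IsProperGroupoid X)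
    (α : DynamicalSystem A) {b : boundedSections A} (hb : b ∈ inducedAlgebra α) :
    toMultiplier (star b * b) ∈ fixedPointAlgebra H α := by
  have := locallyCompactSpace_units (X := X)
  have := t2Space_units (X := X)
  have hbb : star b * b ∈ inducedAlgebra α := mul_mem (star_mem hb) hb
  refine Metric.mem_closure_iff.2 fun ε hε => ?_
  obtain ⟨c, hc, happ⟩ := exists_orbitIntegral_approx H hproper α (b : lp A ∞) b.2 hb.1
    (M := ‖star b * b‖) (fun x => lp.norm_apply_le_norm (by simp)
      ((star b * b : boundedSections A) : lp A ∞) x) hbb.2 (half_pos hε)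
  obtain ⟨f, -, hf⟩ := exists_mem_inducedAlgebra H hproper α
    (isCompactlySupportedSection_star_mul hc hc)
  refine ⟨toMultiplier f, Submodule.subset_span ⟨c, c, f, hc, hc, hf, rfl⟩, ?_⟩
  rw [isometry_toMultiplier.dist_eq, dist_eq_norm]
  refine lt_of_le_of_lt (lp.norm_le_of_forall_le
    (f := ((star b * b - f : boundedSections A) : lp A ∞)) (half_pos hε).le fun u => ?_)
    (half_lt_self hε)
  have := happ u
  rw [← hf u] at this
  exact this

theorem fixedPointAlgebra_eq_map (H : HaarSystem X) (hproper : IsProperGroupoid X)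
    (α : DynamicalSystem A) :
    (fixedPointAlgebra H α : Set 𝓜(ℂ, sectionAlgebra A)) =
      ((inducedAlgebra α).map toMultiplier :
        NonUnitalStarSubalgebra ℂ 𝓜(ℂ, sectionAlgebra A)) := by
  have := locallyCompactSpace_units (X := X)
  have := t2Space_units (X := X)
  -- Closedness of both subalgebras makes Ind complete; the C⋆-algebra structure on Ind used for the
  -- second inclusion depends on it.
  have hc1 : IsClosed (boundedSections A : Set (lp A ∞)) := isClosed_boundedSections A
  have hc2 : IsClosed (inducedAlgebra α : Set (boundedSections A)) := isClosed_inducedAlgebra α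
  refine Set.Subset.antisymm ?_ ?_
  · have : CompleteSpace (boundedSections A) := hc1.completeSpace_coe
    refine Submodule.topologicalClosure_minimal
      (t := ((inducedAlgebra α).map toMultiplier).toSubmodule) _ ?_
      (isometry_toMultiplier.isClosedEmbedding.isClosedMap _ hc2)
    refine Submodule.span_le.2 ?_
    rintro - ⟨a, b, f, ha, hb, hf, rfl⟩
    obtain ⟨f', hf', h⟩ := exists_mem_inducedAlgebra H hproper α
      (isCompactlySupportedSection_star_mul ha hb)
    have : f = f' := Subtype.ext (lp.ext (funext fun u => (hf u).trans (h u).symm))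
    exact ⟨f', hf', by rw [this]; rfl⟩
  · rintro - ⟨f, hf, rfl⟩
    -- The elements of Ind whose multiplier lies in Fix form a linear subspace, so checking the
    -- elements b⋆b suffices.
    exact mem_of_star_mul_self_mem (C := inducedAlgebra α)
      (V := (fixedPointAlgebra H α).comap
        ({ toFun := fun x => toMultiplier (x : boundedSections A)
           map_add' := fun x y => map_add toMultiplier (x : boundedSections A) y
           map_smul' := fun k x => map_smul toMultiplier k (x : boundedSections A) } :
            inducedAlgebra α →ₗ[ℂ] 𝓜(ℂ, sectionAlgebra A)))
      (fun b => toMultiplier_star_mul_self_mem H hproper α b.2) ⟨f, hf⟩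

end Approximation

end GroupoidFix

end

open GroupoidFix
theorem proposition3p6 {X : Type*} [Groupoid X] [TopologicalSpace X] [TopologicalSpace (Arr X)]
    [TopologicalGroupoid X] [SecondCountableTopology (Arr X)] [LocallyCompactSpace (Arr X)]
    [T2Space (Arr X)] [MeasurableSpace (Arr X)] [BorelSpace (Arr X)]
    (H : HaarSystem X) (hprincipal : IsPrincipal X) (hproper : IsProperGroupoid X)
    {A : X → Type*} [∀ x, NonUnitalCStarAlgebra (A x)] [TopologicalSpace (TotalSpace Unit A)]
    [UscCStarBundle A] [TopologicalSpace.SeparableSpace (sectionAlgebra A)]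
    (α : DynamicalSystem A) :
    -- the elements `λ(a⋆b)` of the induced algebra are well defined
    (∀ a b : ∀ x, A x, IsCompactlySupportedSection a → IsCompactlySupportedSection b →
      (∀ u, Integrable (orbitFunction α (fun x => star (a x) * b x) u) (H.measure u)) ∧
      ∃ f ∈ inducedAlgebra α,
        ∀ u, (f : lp A ∞) u = orbitIntegral H α (fun x => star (a x) * b x) u) ∧
    -- the bounded continuous sections are isometrically contained in the multiplier algebra
    Isometry (toMultiplier : boundedSections A →⋆ₙₐ[ℂ] 𝓜(ℂ, sectionAlgebra A)) ∧
    -- the two subalgebras of the multiplier algebra are equal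
    (fixedPointAlgebra H α : Set 𝓜(ℂ, sectionAlgebra A)) =
      ((inducedAlgebra α).map toMultiplier :
        NonUnitalStarSubalgebra ℂ 𝓜(ℂ, sectionAlgebra A)) := by
  have := locallyCompactSpace_units (X := X)
  have := t2Space_units (X := X)
  exact ⟨fun a b ha hb => ⟨integrable_orbitFunction H hproper α
      (isCompactlySupportedSection_star_mul ha hb), exists_mem_inducedAlgebra H hproper α
      (isCompactlySupportedSection_star_mul ha hb)⟩,
    isometry_toMultiplier, fixedPointAlgebra_eq_map H hproper α⟩
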